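/- Let $P$ be a convex polygon in the plane with $m\ge 3$ vertices. A noncrossing partition of $P$ is a partition of its vertex set such that the convex hulls of the blocks are pairwise disjoint; ordered by refinement, these form the noncrossing partition lattice $NC_m$. The noncrossing partition link $\mathrm{Link}(NC_m)$ is the order complex of $NC_m$ with its minimum and maximum removed, so that its maximal simplices correspond to the maximal chains $x_0<x_1<\dots<x_{m-1}$ of $NC_m$. To a noncrossing partition $x$ assign the permutation $\pi_x$ of the vertices of $P$ that sends each vertex to the next vertex, in clockwise order, of its block. A properly ordered noncrossing tree on $P$ is a tree on the vertices of $P$ whose edges, drawn as straight segments, pairwise are disjoint or meet only in a single common vertex, together with a linear ordering of its edges such that the product of the corresponding transpositions, taken in this order, is the $m$-cycle that sends each vertex of $P$ to the clockwise next one. The maximal simplex given by the chain $x_0<\dots<x_{m-1}$ is labeled by the properly ordered noncrossing tree whose $i$-th edge joins the two vertices exchanged by the transposition $\pi_{x_i}\pi_{x_{i-1}}^{-1}$, $i=1,\dots,m-1$ (permutations being composed as functions, and the transposition of the first edge acting first in the product above). Let $e$ be a boundary edge of $P$. Then the union of the maximal simplices of $\mathrm{Link}(NC_m)$ that are labeled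 by properly ordered noncrossing trees not containing $e$ is a contractible subcomplex of $\mathrm{Link}(NC_m)$. -/

import Mathlib

/-! ### Simplicial complexes -/

/-- The geometric realization of a simplicial complex `K` on a finite vertex type `V`, with the
subspace topology of `ℝ^V`: all families of barycentric coordinates supported on a face. -/
def realization {V : Type*} [Finite V] (K : PreAbstractSimplicialComplex V) : Set (V → ℝ) :=
  {f | (∀ v, 0 ≤ f v) ∧ ∃ s ∈ K.faces, (∀ v, v ∉ s → f v = 0) ∧ ∑ v ∈ s, f v = 1}

/-- The order complex of a partially ordered set: its simplices are the nonempty finite chains. -/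
def orderComplex (α : Type*) [PartialOrder α] : PreAbstractSimplicialComplex α where
  faces := {s | s.Nonempty ∧ IsChain (· ≤ ·) (s : Set α)}
  isRelLowerSet_faces := fun _ hs =>
    ⟨hs.1, fun _ hts ht => ⟨ht, hs.2.mono (Finset.coe_subset.2 hts)⟩⟩

/-! ### Convex polygons -/

/-- A convex polygon in the plane with `n + 1` vertices, listed in clockwise order
(the vertices are in strictly convex position). -/
structure ConvexPolygon (n : ℕ) where
  vertex : Fin (n + 1) → ℝ × ℝ
  clockwise : ∀ i j k : Fin (n + 1), i < j → j < k →
    ((vertex j).1 - (vertex i).1) * ((vertex k).2 - (vertex i).2)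
      - ((vertex j).2 - (vertex i).2) * ((vertex k).1 - (vertex i).1) < 0

namespace ConvexPolygon

variable {n : ℕ} (P : ConvexPolygon n)

/-- The convex hull of a set of vertices of the polygon. -/
def hull (s : Set (Fin (n + 1))) : Set (ℝ × ℝ) :=
  convexHull ℝ (P.vertex '' s)

/-! ### Noncrossing partitions -/

/-- The noncrossing partitions of the vertex set of `P`, ordered by refinement. -/
abbrev NC : Type :=
  {p : Finpartition (Finset.univ : Finset (Fin (n + 1))) //
    ∀ s ∈ p.parts, ∀ t ∈ p.parts, s ≠ t → Disjoint (P.hull s) (P.hull t)}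

/-- The noncrossing partition lattice with its bounding elements removed. -/
abbrev ProperNC : Type :=
  {p : P.NC // ¬ IsBot p ∧ ¬ IsTop p}

/-- The noncrossing partition link. -/
def link : PreAbstractSimplicialComplex P.ProperNC :=
  orderComplex P.ProperNC

end ConvexPolygon

/-! ### Noncrossing permutations -/

section NextVertex

variable {n : ℕ}

theorem exists_pos_finRotate_pow_mem_part
    (p : Finpartition (Finset.univ : Finset (Fin (n + 1)))) (v : Fin (n + 1)) :
    ∃ k : ℕ, 0 < k ∧ (finRotate (n + 1) ^ k) v ∈ p.part v :=
  ⟨orderOf (finRotate (n + 1)), orderOf_pos _, by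
    rw [pow_orderOf_eq_one]
    exact p.mem_part (Finset.mem_univ v)⟩

/-- The number of clockwise steps (at least one) from `v` to the next vertex in its block. -/
def stepsToNext (p : Finpartition (Finset.univ : Finset (Fin (n + 1)))) (v : Fin (n + 1)) : ℕ :=
  Nat.find (exists_pos_finRotate_pow_mem_part p v)

/-- The next vertex after `v`, in clockwise order, in the block of `p` that contains `v`. -/
def nextVertex (p : Finpartition (Finset.univ : Finset (Fin (n + 1)))) (v : Fin (n + 1)) :
    Fin (n + 1) :=
  (finRotate (n + 1) ^ stepsToNext p v) v

theorem nextVertex_injective (p : Finpartition (Finset.univ : Finset (Fin (n + 1)))) :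
    Function.Injective (nextVertex p) := by
  have key : ∀ v w, nextVertex p v = nextVertex p w → ¬ stepsToNext p v < stepsToNext p w := by
    intro v w h hlt
    have hv := Nat.find_spec (exists_pos_finRotate_pow_mem_part p v)
    have hw := Nat.find_spec (exists_pos_finRotate_pow_mem_part p w)
    have hv2 : nextVertex p v ∈ p.part v := hv.2
    have hw2 : nextVertex p w ∈ p.part w := hw.2
    have e1 : p.part v = p.part w := by
      rw [← (p.mem_part_iff_part_eq_part (Finset.mem_univ _) (Finset.mem_univ _)).1 hv2,
        ← (p.mem_part_iff_part_eq_part (Finset.mem_univ _) (Finset.mem_univ _)).1 hw2, h]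
    have e2 : (finRotate (n + 1) ^ (stepsToNext p w - stepsToNext p v)) w = v := by
      have h' : (finRotate (n + 1) ^ stepsToNext p v) v
          = (finRotate (n + 1) ^ stepsToNext p w) w := h
      rw [← Nat.add_sub_of_le hlt.le, pow_add, Equiv.Perm.mul_apply] at h'
      exact ((finRotate (n + 1) ^ stepsToNext p v).injective h').symm
    refine Nat.find_min (exists_pos_finRotate_pow_mem_part p w)
      (m := stepsToNext p w - stepsToNext p v) ?_ ⟨Nat.sub_pos_of_lt hlt, ?_⟩
    · have : 0 < stepsToNext p v := hv.1
      exact Nat.sub_lt (this.trans hlt) this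
    · rw [e2, ← e1]
      exact p.mem_part (Finset.mem_univ v)
  intro v w h
  have hk : stepsToNext p v = stepsToNext p w :=
    le_antisymm (not_lt.1 (key w v h.symm)) (not_lt.1 (key v w h))
  have h' : (finRotate (n + 1) ^ stepsToNext p v) v
      = (finRotate (n + 1) ^ stepsToNext p w) w := h
  rw [hk] at h'
  exact (finRotate (n + 1) ^ stepsToNext p w).injective h'

/-- The permutation of the vertices that sends each vertex to the next vertex, in clockwise order,
of its block. -/
noncomputable def blockPerm (p : Finpartition (Finset.univ : Finset (Fin (n + 1)))) :
    Equiv.Perm (Fin (n + 1)) :=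
  Equiv.ofBijective (nextVertex p) (Finite.injective_iff_bijective.1 (nextVertex_injective p))

end NextVertex

/-- The transposition that exchanges the two endpoints of an edge. -/
def edgeSwap {V : Type*} [DecidableEq V] (e : Sym2 V) : Equiv.Perm V :=
  Sym2.lift ⟨fun a b => Equiv.swap a b, fun a b => Equiv.swap_comm a b⟩ e

namespace ConvexPolygon

variable {n : ℕ} (P : ConvexPolygon n)

/-! ### Properly ordered noncrossing trees -/

/-- Two edges are weakly noncrossing when they are disjoint or meet only at a single
common vertex. -/
def WeaklyNoncrossing (e f : Sym2 (Fin (n + 1))) : Prop :=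
  Disjoint (P.hull {v | v ∈ e}) (P.hull {v | v ∈ f}) ∨
    ∃ v, v ∈ e ∧ v ∈ f ∧ P.hull {v | v ∈ e} ∩ P.hull {v | v ∈ f} = {P.vertex v}

/-- A properly ordered noncrossing tree on the vertices of `P`: a noncrossing tree with its edges
listed as `edge 0, …, edge (n - 1)` such that the product of the corresponding transpositions
(`edge 0` acting first) is the cycle given by the boundary of `P`. -/
structure ProperlyOrderedTree where
  edge : Fin n → Sym2 (Fin (n + 1))
  edge_injective : Function.Injective edge
  not_isDiag : ∀ i, ¬ (edge i).IsDiag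
  isTree : (SimpleGraph.fromEdgeSet (Set.range edge)).IsTree
  noncrossing : ∀ i j, i ≠ j → P.WeaklyNoncrossing (edge i) (edge j)
  proper : (List.ofFn fun i => edgeSwap (edge i)).reverse.prod = finRotate (n + 1)

/-! ### Maximal chains and their labels -/

/-- A maximal chain of the noncrossing partition lattice: `n + 1` elements, from the bottom to the
top, each covered by the next one. -/
structure MaximalChain where
  elem : Fin (n + 1) → P.NC
  isBot : IsBot (elem 0)
  isTop : IsTop (elem (Fin.last n))
  covBy : ∀ i : Fin n, elem i.castSucc ⋖ elem i.succ

variable {P}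

/-- The tree `T` labels the maximal chain `C`: the `i`-th edge of `T` is the transposition assigned
to the `i`-th covering relation of `C`, which is the permutation of the bigger element times the
inverse of the permutation of the smaller one. -/
def ProperlyOrderedTree.Labels (T : P.ProperlyOrderedTree) (C : P.MaximalChain) : Prop :=
  ∀ i : Fin n, blockPerm (C.elem i.succ).1 * (blockPerm (C.elem i.castSucc).1)⁻¹
    = edgeSwap (T.edge i)

variable (P)

/-- The union of the top simplices of the noncrossing partition link (with all of their faces) that
are labeled by properly ordered noncrossing trees omitting the edge `e`. -/
def omittingComplex (e : Sym2 (Fin (n + 1))) : PreAbstractSimplicialComplex P.ProperNC where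
  faces := {s | s.Nonempty ∧ ∃ (T : P.ProperlyOrderedTree) (C : P.MaximalChain),
    T.Labels C ∧ e ∉ Set.range T.edge ∧ ∀ x ∈ s, (x : P.NC) ∈ Set.range C.elem}
  isRelLowerSet_faces := by
    rintro s ⟨hs, T, C, hTC, he, hsC⟩
    exact ⟨hs, fun t hts ht => ⟨ht, T, C, hTC, he, fun x hx => hsC x (hts hx)⟩⟩

end ConvexPolygon

/-! ### Geometric realizations and cones. -/

section Realization

variable {V : Type*}

/-! Write `e = {i, i'}` with `i'` the clockwise successor of `i`. Let `M` be the set of proper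
noncrossing partitions that join `i` to some vertex but not to `i'`, and `T` the set of those that
join `i` to `i'`. Along a maximal chain the block of `i` starts as a singleton and ends up
containing `i'`. The label uses `e` exactly when both changes happen in the same step, that is, when
the chain misses `M` (`notMem_range_edge_iff`). Every maximal chain has a label (`exists_labels`)
and every chain extends to a maximal one (`exists_maximalChain_of_isChain`), so the complex in
question is the union of the closed stars of the elements of `M` (`omittingComplex_eq_starComplex`).

This union is contracted by deleting the elements of `T`, maximal ones first
(`contractibleSpace_realization_starComplex`). The link of the element `z` to be deleted lies below
`z` and is again a union of stars of elements of `M`, now in the open lower interval of `z`, so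
induction applies. Contractible deletion and link give a contractible complex. Once `T` is
exhausted, what remains is the order complex of the elements lying below some element of `M`; it
contracts through `x ≤ x ∨ p ≥ p` (`contractibleSpace_realization_chainComplex`).

The element `p` depends on the upper bound `z` (the top partition at the outset). If `v` precedes
`i` in its `z`-block, then `p` has `{v, i}` as its only nontrivial block, and `x ∨ p` merges the
`x`-blocks of `v` and `i`. This merge is noncrossing because `v` and `i` are consecutive in a block
of the coarser `z` (`merge_nextVertex`), and it does not join `i` to `i'` because otherwise an
element of `M` above `x` would have crossing blocks (`exists_merge`). -/

theorem PreAbstractSimplicialComplex.mem_faces_of_subset {K : PreAbstractSimplicialComplex V}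
    {s t : Finset V} (hs : s ∈ K.faces) (hts : t ⊆ s) (ht : t.Nonempty) : t ∈ K.faces :=
  (K.isRelLowerSet_faces hs).2 hts ht

theorem mem_realization_of_support_subset [Fintype V] {K : PreAbstractSimplicialComplex V}
    {f : V → ℝ} (h0 : ∀ v, 0 ≤ f v) (h1 : ∑ v, f v = 1) {s : Finset V} (hs : s ∈ K.faces)
    (hf : ∀ v, v ∉ s → f v = 0) : f ∈ realization K :=
  ⟨h0, s, hs, hf, by rw [← h1]; exact Finset.sum_subset (Finset.subset_univ s) fun v _ => hf v⟩

theorem sum_eq_one_of_mem_realization [Fintype V] {K : PreAbstractSimplicialComplex V} {f : V → ℝ}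
    (hf : f ∈ realization K) : ∑ v, f v = 1 := by
  obtain ⟨-, s, -, h, h1⟩ := hf
  rw [← h1]
  exact (Finset.sum_subset (Finset.subset_univ s) fun v _ => h v).symm

theorem realization_mono [Finite V] {K L : PreAbstractSimplicialComplex V}
    (h : K.faces ⊆ L.faces) : realization K ⊆ realization L :=
  fun _ ⟨h0, s, hs, hf⟩ => ⟨h0, s, h hs, hf⟩

theorem mem_realization_le_one [Fintype V] {K : PreAbstractSimplicialComplex V} {f : V → ℝ}
    (hf : f ∈ realization K) (v : V) : f v ≤ 1 := by
  rw [← sum_eq_one_of_mem_realization hf]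
  exact Finset.single_le_sum (fun w _ => hf.1 w) (Finset.mem_univ v)

/-- Compactness is what makes a continuous surjection between such spaces a quotient map, so that
homotopies can be glued. -/
theorem isCompact_realization [Finite V] (K : PreAbstractSimplicialComplex V) :
    IsCompact (realization K) := by
  have := Fintype.ofFinite V
  have hbox : IsCompact (Set.univ.pi fun _ : V => Set.Icc (0 : ℝ) 1) :=
    isCompact_univ_pi fun _ => isCompact_Icc
  refine hbox.of_isClosed_subset ?_ fun f hf v _ => ⟨hf.1 v, mem_realization_le_one hf v⟩
  have : realization K = (⋂ v, {f | 0 ≤ f v}) ∩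
      ⋃ s ∈ K.faces, ((⋂ v ∈ {v | v ∉ s}, {f : V → ℝ | f v = 0}) ∩ {f | ∑ v ∈ s, f v = 1}) := by
    ext f
    simp [realization, and_left_comm]
  rw [this]
  refine (isClosed_iInter fun v => isClosed_le continuous_const (continuous_apply v)).inter
    (Set.Finite.isClosed_biUnion (Set.toFinite _) fun s _ => ?_)
  exact (isClosed_biInter fun v _ => isClosed_eq (continuous_apply v) continuous_const).inter
    (isClosed_eq (continuous_finsetSum _ fun v _ => continuous_apply v) continuous_const)

instance [Finite V] (K : PreAbstractSimplicialComplex V) : CompactSpace (realization K) :=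
  isCompact_iff_compactSpace.1 (isCompact_realization K)

theorem combo_single_mem_realization [Fintype V] [DecidableEq V]
    {K L : PreAbstractSimplicialComplex V} {a : V}
    (ha : ∀ s ∈ L.faces, insert a s ∈ K.faces) {f : V → ℝ} (hf : f ∈ realization L) {t : ℝ}
    (ht0 : 0 ≤ t) (ht1 : t ≤ 1) : (1 - t) • f + t • Pi.single a 1 ∈ realization K := by
  have h1 := sum_eq_one_of_mem_realization hf
  obtain ⟨h0, s, hs, hsf, -⟩ := hf
  refine mem_realization_of_support_subset (fun v => ?_) ?_ (ha s hs) fun v hv => ?_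
  · have : (0 : ℝ) ≤ (Pi.single a 1 : V → ℝ) v := by
      by_cases h : v = a
      · subst h; simp
      · simp [h]
    have := mul_nonneg (sub_nonneg.2 ht1) (h0 v)
    simp only [Pi.add_apply, Pi.smul_apply, smul_eq_mul]
    positivity
  · simp [Finset.sum_add_distrib, ← Finset.mul_sum, h1]
  · rw [Finset.mem_insert, not_or] at hv
    simp [hsf v hv.2, hv.1]

/-- A simplicial cone has a contractible realization. -/
theorem contractibleSpace_realization_of_cone [Finite V] [DecidableEq V]
    {K : PreAbstractSimplicialComplex V} {a : V} (ha : {a} ∈ K.faces)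
    (h : ∀ s ∈ K.faces, insert a s ∈ K.faces) : ContractibleSpace (realization K) := by
  have := Fintype.ofFinite V
  have hmem : (Pi.single a 1 : V → ℝ) ∈ realization K := by
    refine mem_realization_of_support_subset (fun v => ?_) (by simp) ha fun v hv => ?_
    · by_cases h : v = a
      · subst h; simp
      · simp [h]
    · simp only [Finset.mem_singleton] at hv
      simp [hv]
  refine StarConvex.contractibleSpace (x := (Pi.single a 1 : V → ℝ)) ?_ ⟨_, hmem⟩
  intro f hf t u ht hu htu
  have := combo_single_mem_realization h hf ht (by linarith)
  rwa [add_comm, show 1 - t = u by linarith] at this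

end Realization

/-! ### Gluing a cone over a contractible link. -/

section VertexRemoval

open unitInterval

variable {V : Type*} [Fintype V] [DecidableEq V] {K K' L : PreAbstractSimplicialComplex V} {v : V}

/-- The complex is the deletion of `v` together with the cone over its link: drop the `v`-coordinate
and rescale. At the apex itself nothing is left to rescale, and nonemptiness of the link supplies an
arbitrary base point. -/
theorem exists_combo_of_mem_realization
    (hK' : ∀ s, s ∈ K'.faces ↔ s ∈ K.faces ∧ v ∉ s)
    (hL : ∀ s, s ∈ L.faces ↔ s.Nonempty ∧ v ∉ s ∧ insert v s ∈ K.faces)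
    [Nonempty (realization L)] {f : V → ℝ} (hf : f ∈ realization K) :
    f ∈ realization K' ∨ ∃ y ∈ realization L, ∃ t ∈ I, (1 - t) • y + t • Pi.single v 1 = f := by
  have h1 := sum_eq_one_of_mem_realization hf
  have hle := mem_realization_le_one hf v
  obtain ⟨h0, s, hs, hsf, hsum⟩ := hf
  have hsub : ∑ w, (f - f v • (Pi.single v 1 : V → ℝ)) w = 1 - f v := by simp [h1, ← Finset.mul_sum]
  have hne : f v < 1 → (s.erase v).Nonempty := by
    intro hlt
    rw [Finset.nonempty_iff_ne_empty]
    intro he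
    have : ∑ w ∈ s, f w ≤ ∑ w ∈ {v}, f w := by
      refine Finset.sum_le_sum_of_subset_of_nonneg ?_ fun w _ _ => h0 w
      intro w hw
      by_contra h
      have : w ∈ s.erase v := Finset.mem_erase.2 ⟨by simpa using h, hw⟩
      simp [he] at this
    simp only [Finset.sum_singleton] at this
    linarith
  rcases (h0 v).eq_or_lt with hv | hv
  · left
    have hn := hne (by linarith)
    refine mem_realization_of_support_subset h0 h1 (s := s.erase v) ((hK' _).2
      ⟨K.mem_faces_of_subset hs (Finset.erase_subset v s) hn, by simp⟩) fun w hw => ?_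
    by_cases h : w = v
    · rw [h, ← hv]
    · exact hsf w fun hws => hw (Finset.mem_erase.2 ⟨h, hws⟩)
  · right
    have hvs : v ∈ s := by
      by_contra h
      exact hv.ne' (hsf v h)
    rcases hle.eq_or_lt with h | h
    · obtain ⟨y, hy⟩ := ‹Nonempty (realization L)›
      refine ⟨y, hy, 1, ⟨zero_le_one, le_rfl⟩, ?_⟩
      ext w
      by_cases hw : w = v
      · subst hw; simp [h]
      · have : f w + f v ≤ 1 := by
          rw [← h1, ← Finset.sum_pair hw]
          exact Finset.sum_le_sum_of_subset_of_nonneg (Finset.subset_univ _) fun x _ _ => h0 x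
        have := h0 w
        simp only [sub_self, zero_smul, one_smul, zero_add, Pi.single_eq_of_ne hw]
        linarith
    · have hpos : 0 < 1 - f v := by linarith
      have hn := hne h
      refine ⟨(1 - f v)⁻¹ • (f - f v • (Pi.single v 1 : V → ℝ)), ?_, f v, ⟨hv.le, hle⟩, ?_⟩
      · refine mem_realization_of_support_subset (s := s.erase v) (fun w => ?_) ?_
          ((hL _).2 ⟨hn, by simp, by rwa [Finset.insert_erase hvs]⟩) fun w hw => ?_
        · by_cases hw : w = v
          · subst hw; simp
          · simp only [Pi.smul_apply, Pi.sub_apply, Pi.single_eq_of_ne hw, smul_eq_mul, mul_zero,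
              sub_zero]
            exact mul_nonneg (inv_nonneg.2 hpos.le) (h0 w)
        · simp_rw [Pi.smul_apply (1 - f v)⁻¹, ← Finset.smul_sum, hsub, smul_eq_mul]
          exact inv_mul_cancel₀ hpos.ne'
        · by_cases h : w = v
          · subst h; simp
          · simp [h, hsf w fun hws => hw (Finset.mem_erase.2 ⟨h, hws⟩)]
      · rw [smul_smul, mul_inv_cancel₀ hpos.ne', one_smul, sub_add_cancel]

/-- If the deletion and the link of a vertex are contractible then so is the complex. -/
theorem contractibleSpace_realization_of_deletion_of_link
    (hK' : ∀ s, s ∈ K'.faces ↔ s ∈ K.faces ∧ v ∉ s)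
    (hL : ∀ s, s ∈ L.faces ↔ s.Nonempty ∧ v ∉ s ∧ insert v s ∈ K.faces)
    (hcK' : ContractibleSpace (realization K')) (hcL : ContractibleSpace (realization L)) :
    ContractibleSpace (realization K) := by
  have hKK : realization K' ⊆ realization K := realization_mono fun s hs => ((hK' s).1 hs).1
  have hLK' : realization L ⊆ realization K' := realization_mono fun s hs =>
    (hK' s).2 ⟨K.mem_faces_of_subset ((hL s).1 hs).2.2 (Finset.subset_insert v s)
      ((hL s).1 hs).1, ((hL s).1 hs).2.1⟩
  have hv' : ∀ f ∈ realization K', f v = 0 := fun f ⟨_, s, hs, hsf, _⟩ => hsf v ((hK' s).1 hs).2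
  have hins : ∀ s ∈ L.faces, insert v s ∈ K.faces := fun s hs => ((hL s).1 hs).2.2
  obtain ⟨l₀, ⟨H⟩⟩ := (contractible_iff_id_nullhomotopic (realization L)).1 hcL
  -- the cone over the link
  let cone : C(realization L × I, realization K) :=
    ⟨fun p => ⟨(1 - (p.2 : ℝ)) • (p.1 : V → ℝ) + (p.2 : ℝ) • Pi.single v 1,
      combo_single_mem_realization hins p.1.2 p.2.2.1 p.2.2.2⟩, by fun_prop⟩
  let incl : C(realization K', realization K) := ⟨Set.inclusion hKK, continuous_inclusion hKK⟩
  let Q : C((realization K' × I) ⊕ ((realization L × I) × I), realization K × I) :=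
    ⟨Sum.elim (fun p => (incl p.1, p.2)) (fun p => (cone p.1, p.2)), by fun_prop⟩
  -- The homotopy fixes the deletion. On the cone point at height `t` it first runs the contraction
  -- of the link up to parameter `t`, then lowers the height to `0`: at time `s` the parameter is
  -- `min(1, 2s) * t` and the height `min(1, 2 - 2s) * t`. Both vanish for `t = 0`, which matches
  -- the deletion.
  let a : C(I × I, I) := ⟨fun p => Set.projIcc 0 1 zero_le_one (2 * (p.2 : ℝ)) * p.1, by fun_prop⟩
  let τ : C(I × I, I) :=
    ⟨fun p => Set.projIcc 0 1 zero_le_one (2 - 2 * (p.2 : ℝ)) * p.1, by fun_prop⟩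
  let G : C((realization K' × I) ⊕ ((realization L × I) × I), realization K) :=
    ⟨Sum.elim (fun p => incl p.1)
      (fun p => cone (H (a (p.1.2, p.2), p.1.1), τ (p.1.2, p.2))), by fun_prop⟩
  have hconev : ∀ p : realization L × I, (cone p : V → ℝ) v = p.2 := by
    intro p
    simp [cone, hv' _ (hLK' p.1.2)]
  have hcone0 : ∀ y, (cone (y, 0) : V → ℝ) = y := by
    intro y
    simp [cone]
  have hcone1 : ∀ y y', cone (y, 1) = cone (y', 1) := by
    intro y y'
    simp [cone]
  have ha0 : ∀ s, a (0, s) = 0 := fun s => by simp [a]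
  have hτ0 : ∀ s, τ (0, s) = 0 := fun s => by simp [τ]
  -- At the apex either the link is fully contracted or the height is still `1`; in both cases the
  -- base point no longer matters, so the homotopy is well defined there.
  have h1 : ∀ s, a (1, s) = 1 ∨ τ (1, s) = 1 := by
    intro s
    rcases le_total (1 / 2 : ℝ) s with h | h
    · left
      simp only [a, ContinuousMap.coe_mk, mul_one]
      exact Set.projIcc_of_right_le _ (by linarith)
    · right
      simp only [τ, ContinuousMap.coe_mk, mul_one]
      exact Set.projIcc_of_right_le _ (by linarith)
  have hconeinj : ∀ p q, cone p = cone q → p.2 = q.2 ∧ (p.2 = 1 ∨ p.1 = q.1) := by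
    rintro ⟨y, t⟩ ⟨y', t'⟩ h
    have ht : t = t' := by
      have := congrArg (fun f : realization K => (f : V → ℝ) v) h
      simp only [hconev] at this
      exact Subtype.ext this
    subst ht
    refine ⟨rfl, ?_⟩
    rcases eq_or_ne t 1 with h1 | h1
    · exact Or.inl h1
    · right
      have h2 := congrArg Subtype.val h
      simp only [cone, ContinuousMap.coe_mk, add_left_inj] at h2
      have h3 : (1 - (t : ℝ)) ≠ 0 := sub_ne_zero.2 fun h => h1 (Subtype.ext h.symm)
      exact Subtype.ext (smul_right_injective _ h3 h2)
  have hcases : ∀ x : realization K, (∃ k, incl k = x) ∨ ∃ p, cone p = x := by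
    intro x
    rcases exists_combo_of_mem_realization hK' hL x.2 with h | ⟨y, hy, t, ht, h⟩
    · exact Or.inl ⟨⟨x, h⟩, rfl⟩
    · exact Or.inr ⟨(⟨y, hy⟩, ⟨t, ht⟩), Subtype.ext h⟩
  have hQ : Topology.IsQuotientMap Q := by
    refine Topology.IsQuotientMap.of_surjective_continuous ?_ Q.continuous
    rintro ⟨x, s⟩
    rcases hcases x with ⟨k, rfl⟩ | ⟨p, rfl⟩
    · exact ⟨Sum.inl (k, s), rfl⟩
    · exact ⟨Sum.inr (p, s), rfl⟩
  have hGinr : ∀ k y t s, incl k = cone (y, t) →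
      G (Sum.inl (k, s)) = G (Sum.inr ((y, t), s)) := by
    intro k y t s h
    have ht : t = 0 := by
      have := congrArg (fun f : realization K => (f : V → ℝ) v) h
      simp only [hconev] at this
      exact Subtype.ext (this.symm.trans (hv' _ k.2))
    subst ht
    simp only [G, ContinuousMap.coe_mk, Sum.elim_inl, Sum.elim_inr, ha0, hτ0, H.apply_zero,
      ContinuousMap.id_apply]
    exact h
  have hG : ∀ x y, Q x = Q y → G x = G y := by
    rintro (⟨k, s⟩ | ⟨⟨y, t⟩, s⟩) (⟨k', s'⟩ | ⟨⟨y', t'⟩, s'⟩) h <;>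
      simp only [Q, ContinuousMap.coe_mk, Sum.elim_inl, Sum.elim_inr, Prod.mk.injEq] at h <;>
      obtain ⟨h, rfl⟩ := h
    · exact h
    · exact hGinr _ _ _ _ h
    · exact (hGinr _ _ _ _ h.symm).symm
    · obtain ⟨h2, h3⟩ := hconeinj _ _ h
      dsimp only at h2 h3
      subst h2
      rcases h3 with rfl | rfl
      · simp only [G, ContinuousMap.coe_mk, Sum.elim_inr]
        rcases h1 s with h1 | h1
        · rw [h1, H.apply_one, H.apply_one]; rfl
        · rw [h1]; exact hcone1 _ _
      · rfl
  let F : C(realization K × I, realization K) := hQ.lift G hG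
  have hF : ∀ z, F (Q z) = G z := fun z => congrFun (congrArg DFunLike.coe (hQ.lift_comp G hG)) z
  have hF0 : ∀ x, F (x, 0) = x := by
    intro x
    rcases hcases x with ⟨k, rfl⟩ | ⟨⟨y, t⟩, rfl⟩
    · exact hF (Sum.inl (k, 0))
    · refine (hF (Sum.inr ((y, t), 0))).trans ?_
      have ha : a (t, 0) = 0 := by
        simp [a]
      have hτ : τ (t, 0) = t := by
        simp [τ, Set.projIcc_of_right_le]
      simp only [G, ContinuousMap.coe_mk, Sum.elim_inr, ha, hτ, H.apply_zero,
        ContinuousMap.id_apply]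
  -- At time `1` every height is `0`, so the identity is homotopic to a map that factors through the
  -- contractible deletion.
  have hF1 : ∀ x, (F (x, 1) : V → ℝ) ∈ realization K' := by
    intro x
    rcases hcases x with ⟨k, rfl⟩ | ⟨⟨y, t⟩, rfl⟩
    · rw [show F (incl k, 1) = incl k from hF (Sum.inl (k, 1))]
      exact k.2
    · rw [show F (cone (y, t), 1) = _ from hF (Sum.inr ((y, t), 1))]
      have hτ : τ (t, 1) = 0 := by
        simp [τ]
      simp only [G, ContinuousMap.coe_mk, Sum.elim_inr, hτ, hcone0]
      exact hLK' (H _).2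
  let R : C(realization K, realization K') :=
    ⟨fun x => ⟨F (x, 1), hF1 x⟩, by fun_prop⟩
  have hnull : (incl.comp R).Nullhomotopic := by
    have := ((contractible_iff_id_nullhomotopic (realization K')).1 hcK').comp_left R
    rw [ContinuousMap.id_comp] at this
    exact this.comp_right incl
  rw [contractible_iff_id_nullhomotopic]
  obtain ⟨x₀, hx₀⟩ := hnull
  refine ⟨x₀, ContinuousMap.Homotopic.trans ⟨⟨F.comp ⟨Prod.swap, continuous_swap⟩, fun x => ?_,
    fun x => ?_⟩⟩ hx₀⟩
  · exact hF0 x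
  · rfl

end VertexRemoval

/-! ### Order complexes and unions of stars in finite posets. -/

section PosetComplexes

variable {α : Type*} [PartialOrder α]

/-- The order complex of a subset of a poset. -/
def chainComplex (A : Set α) : PreAbstractSimplicialComplex α where
  faces := {s | s.Nonempty ∧ ↑s ⊆ A ∧ IsChain (· ≤ ·) (s : Set α)}
  isRelLowerSet_faces := fun _ hs =>
    ⟨hs.1, fun _ hts ht => ⟨ht, (Finset.coe_subset.2 hts).trans hs.2.1,
      hs.2.2.mono (Finset.coe_subset.2 hts)⟩⟩

/-- The union of the closed stars of the elements of `M` in the order complex of `D`. -/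
def starComplex (M D : Set α) : PreAbstractSimplicialComplex α where
  faces := {s | s.Nonempty ∧ ↑s ⊆ D ∧ ∃ m ∈ M ∩ D, IsChain (· ≤ ·) (insert m (s : Set α))}
  isRelLowerSet_faces := by
    rintro s ⟨hs, hsD, m, hm, hc⟩
    exact ⟨hs, fun t hts ht => ⟨ht, (Finset.coe_subset.2 hts).trans hsD, m, hm,
      hc.mono (Set.insert_subset_insert (Finset.coe_subset.2 hts))⟩⟩

theorem isChain_le_insert_iff {s : Set α} {a : α} :
    IsChain (· ≤ ·) (insert a s) ↔ IsChain (· ≤ ·) s ∧ ∀ b ∈ s, a ≤ b ∨ b ≤ a := by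
  constructor
  · intro h
    refine ⟨h.mono (Set.subset_insert a s), fun b hb => ?_⟩
    exact h.total (Set.mem_insert a s) (Set.mem_insert_of_mem a hb)
  · rintro ⟨h, h'⟩
    exact h.insert fun b hb _ => h' b hb

variable [Finite α]

/-- A poset `A` with an element `p` that has a join with each element of `A` is conically
contractible. -/
theorem contractibleSpace_realization_chainComplex {A : Set α} {p : α} (hp : p ∈ A)
    (hj : ∀ x ∈ A, ∃ j ∈ A, IsLUB {x, p} j) :
    ContractibleSpace (realization (chainComplex A)) := by
  classical
  have := Fintype.ofFinite α
  -- Elements not above `p` are removed one at a time, maximal ones first; when none is left, the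
  -- complex is a cone with apex `p`.
  suffices ∀ (k : ℕ) (B : Set α), B ⊆ A → (∀ x ∈ A, p ≤ x → x ∈ B) →
      (B \ Set.Ici p).ncard = k → ContractibleSpace (realization (chainComplex B)) from
    this _ A le_rfl (fun x hx _ => hx) rfl
  intro k
  induction k with
  | zero =>
    intro B hBA hB hk
    rw [Set.ncard_eq_zero, Set.sdiff_eq_empty] at hk
    refine contractibleSpace_realization_of_cone (a := p) ?_ ?_
    · exact ⟨by simp, by simpa using hB p hp le_rfl, by simp⟩
    · rintro s ⟨-, hsB, hs⟩
      refine ⟨by simp, ?_, ?_⟩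
      · rw [Finset.coe_insert]
        exact Set.insert_subset (hB p hp le_rfl) hsB
      · rw [Finset.coe_insert, isChain_le_insert_iff]
        exact ⟨hs, fun b hb => Or.inl (hk (hsB hb))⟩
  | succ k ih =>
    intro B hBA hB hk
    have hne : (B \ Set.Ici p).Nonempty := by
      rw [← Set.ncard_pos]; omega
    obtain ⟨x, hx⟩ := (Set.toFinite (B \ Set.Ici p)).exists_maximal hne
    obtain ⟨j, hjA, hj⟩ := hj x (hBA hx.prop.1)
    have hxj : x ≤ j := hj.1 (by simp)
    have hpj : p ≤ j := hj.1 (by simp)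
    have hjB : j ∈ B := hB j hjA hpj
    have hjx : j ≠ x := fun h => hx.prop.2 (h ▸ hpj)
    -- By maximality everything strictly above `x` is above `p`, hence above the join `j`; so the
    -- link of `x` is a cone with apex `j`.
    have habove : ∀ y ∈ B, x ≤ y → y ≠ x → j ≤ y := by
      intro y hy hxy hne
      have : p ≤ y := by
        by_contra h
        exact hne (le_antisymm (hx.le_of_ge ⟨hy, h⟩ hxy) hxy)
      exact hj.2 (by rintro z (rfl | rfl) <;> assumption)
    refine contractibleSpace_realization_of_deletion_of_link (v := x)
      (K' := chainComplex (B \ {x}))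
      (L := { faces := {s | s.Nonempty ∧ x ∉ s ∧ insert x s ∈ (chainComplex B).faces}
              isRelLowerSet_faces := fun s hs => ⟨hs.1, fun t hts ht => ⟨ht, fun h => hs.2.1 (hts h),
                PreAbstractSimplicialComplex.mem_faces_of_subset hs.2.2
                  (Finset.insert_subset_insert x hts) (by simp)⟩⟩ })
      ?_ (fun s => Iff.rfl) ?_ ?_
    · intro s
      constructor
      · rintro ⟨h1, h2, h3⟩
        exact ⟨⟨h1, h2.trans Set.sdiff_subset, h3⟩, fun h => (h2 h).2 rfl⟩
      · rintro ⟨⟨h1, h2, h3⟩, h4⟩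
        exact ⟨h1, fun y hy => ⟨h2 hy, by rintro rfl; exact h4 hy⟩, h3⟩
    · refine ih _ (Set.sdiff_subset.trans hBA) (fun y hy hpy => ⟨hB y hy hpy, ?_⟩) ?_
      · rintro rfl
        exact hx.prop.2 hpy
      · rw [show (B \ {x}) \ Set.Ici p = (B \ Set.Ici p) \ {x} by ext; simp; tauto,
          Set.ncard_sdiff_singleton_of_mem hx.prop]
        omega
    · refine contractibleSpace_realization_of_cone (a := j) ?_ ?_
      · refine ⟨by simp, by simpa using hjx.symm, by simp, ?_, ?_⟩
        · simp [Set.insert_subset_iff, hx.prop.1, hjB]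
        · rw [Finset.coe_insert, isChain_le_insert_iff]
          simp [hxj]
      · rintro s ⟨-, hxs, -, h2, h3⟩
        refine ⟨by simp, by simp [hjx.symm, hxs], by simp, ?_, ?_⟩
        · rw [Finset.coe_insert] at h2
          rw [Finset.insert_comm, Finset.coe_insert, Finset.coe_insert]
          exact Set.insert_subset hjB h2
        · rw [Finset.insert_comm, Finset.coe_insert, isChain_le_insert_iff]
          refine ⟨h3, fun y hy => ?_⟩
          rw [Finset.coe_insert] at h2 h3 hy
          rcases eq_or_ne y x with rfl | hyx
          · exact Or.inr hxj
          · rcases h3.total (Set.mem_insert x _) hy with h | h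
            · exact Or.inl (habove y (h2 hy) h hyx)
            · exact Or.inr (h.trans hxj)

/-- A union of stars of the order complex of a finite poset is contractible when suitable joins
exist in the poset and in its lower intervals that are bounded by elements of an upper set
avoiding the centers of the stars. -/
theorem contractibleSpace_realization_starComplex {M T : Set α} (hT : IsUpperSet T)
    (hMT : Disjoint M T) (hup : IsUpperSet (M ∪ T))
    (hjoin : ∀ E : Set α, (E = Set.univ ∨ ∃ z ∈ T, E = Set.Iio z) → (M ∩ E).Nonempty →
      ∃ p ∈ M ∩ E, ∀ m ∈ M ∩ E, ∀ x ≤ m, ∃ j ∈ M ∩ E, IsLUB {x, p} j)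
    (hM : M.Nonempty) : ContractibleSpace (realization (starComplex M Set.univ)) := by
  classical
  have := Fintype.ofFinite α
  have hMT' : ∀ x ∈ M, x ∉ T := fun x h1 h2 => Set.disjoint_left.1 hMT h1 h2
  -- Here `E` is the ambient interval and `D` is what is left of it after some elements of `T` have
  -- been deleted; all of `M ∩ E` survives. Passing to a link replaces both by a smaller interval.
  suffices ∀ (k : ℕ) (E D : Set α), (E = Set.univ ∨ ∃ z ∈ T, E = Set.Iio z) → (M ∩ E).Nonempty →
      IsLowerSet D → E \ T ⊆ D → D ⊆ E → (D ∩ T).ncard = k →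
      ContractibleSpace (realization (starComplex M D)) from
    this _ Set.univ Set.univ (Or.inl rfl) (by simpa using hM) isLowerSet_univ
      (Set.subset_univ _) le_rfl rfl
  intro k
  induction k using Nat.strong_induction_on with
  | _ k ih =>
  intro E D hE hME hD hED hDE hk
  have hMD : M ∩ D = M ∩ E := by
    ext x
    exact ⟨fun h => ⟨h.1, hDE h.2⟩, fun h => ⟨h.1, hED ⟨h.2, hMT' x h.1⟩⟩⟩
  rcases (D ∩ T).eq_empty_or_nonempty with h0 | hne
  · obtain ⟨p, hp, hj⟩ := hjoin E hE hME
    have hDT : ∀ x ∈ D, x ∉ T := fun x h1 h2 => by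
      have : x ∈ D ∩ T := ⟨h1, h2⟩
      simp [h0] at this
    -- With no element of `T` left, anything above an element of `M` is itself in `M`. Hence a chain
    -- lies in a star exactly when its maximum is below an element of `M`.
    have key : starComplex M D = chainComplex {x | x ∈ D ∧ ∃ m ∈ M ∩ E, x ≤ m} := by
      ext s
      constructor
      · rintro ⟨h1, h2, m, hm, h3⟩
        rw [isChain_le_insert_iff] at h3
        refine ⟨h1, fun x hx => ⟨h2 hx, ?_⟩, h3.1⟩
        rw [← hMD]
        rcases h3.2 x hx with h | h
        · refine ⟨x, ⟨?_, h2 hx⟩, le_rfl⟩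
          exact (hup h (Or.inl hm.1)).resolve_right (hDT x (h2 hx))
        · exact ⟨m, hm, h⟩
      · rintro ⟨h1, h2, h3⟩
        refine ⟨h1, fun x hx => (h2 hx).1, ?_⟩
        obtain ⟨x, hx⟩ := s.exists_maximal h1
        obtain ⟨m, hm, hxm⟩ := (h2 hx.prop).2
        refine ⟨m, hMD ▸ hm, isChain_le_insert_iff.2 ⟨h3, fun b hb => Or.inr ?_⟩⟩
        rcases h3.total hb hx.prop with h | h
        · exact h.trans hxm
        · exact (hx.le_of_ge hb h).trans hxm
    rw [key]
    have hMA : ∀ x ∈ M ∩ E, x ∈ {x | x ∈ D ∧ ∃ m ∈ M ∩ E, x ≤ m} :=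
      fun x hx => ⟨(hMD ▸ hx : x ∈ M ∩ D).2, x, hx, le_rfl⟩
    refine contractibleSpace_realization_chainComplex (hMA p hp) ?_
    rintro x ⟨hx, m, hm, hxm⟩
    obtain ⟨j, hj, hlub⟩ := hj m hm x hxm
    exact ⟨j, hMA j hj, hlub⟩
  · obtain ⟨z, hz⟩ := (Set.toFinite (D ∩ T)).exists_maximal hne
    have hzM : z ∉ M := fun h => hMT' z h hz.prop.2
    have hzmax : ∀ y ∈ D, z ≤ y → y = z := fun y hy hzy =>
      le_antisymm (hz.le_of_ge ⟨hy, hT hzy hz.prop.2⟩ hzy) hzy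
    have hmz : M ∩ (D \ {z}) = M ∩ D := by
      ext x
      exact ⟨fun h => ⟨h.1, h.2.1⟩, fun h => ⟨h.1, h.2, by rintro rfl; exact hzM h.1⟩⟩
    have hDz : IsLowerSet (D \ {z}) := by
      intro a b hba ha
      refine ⟨hD hba ha.1, ?_⟩
      rintro rfl
      exact ha.2 (hzmax a ha.1 hba)
    have hED' : E \ T ⊆ D \ {z} := fun x hx => ⟨hED hx, by
      rintro rfl
      exact hx.2 hz.prop.2⟩
    have hdel : ContractibleSpace (realization (starComplex M (D \ {z}))) := by
      refine ih _ ?_ E (D \ {z}) hE hME hDz hED' (Set.sdiff_subset.trans hDE) rfl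
      rw [← hk]
      refine Set.ncard_lt_ncard ⟨fun x hx => ⟨hx.1.1, hx.2⟩, fun h => ?_⟩
      exact (h hz.prop).1.2 rfl
    have hstar : ∀ s, s ∈ (starComplex M (D \ {z})).faces ↔
        s ∈ (starComplex M D).faces ∧ z ∉ s := by
      intro s
      change (_ ∧ _ ∧ _) ↔ (_ ∧ _ ∧ _) ∧ _
      rw [hmz, Set.subset_sdiff, Set.disjoint_singleton_right, Finset.mem_coe]
      tauto
    have hcomp : ∀ m ∈ D, z ≤ m ∨ m ≤ z → m ≠ z → m < z := by
      rintro m hm (h | h) hne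
      · exact absurd (hzmax m hm h) hne
      · exact lt_of_le_of_ne h hne
    have hlt : Set.Iio z ⊆ D := fun x hx => hD (le_of_lt hx) hz.prop.1
    -- If no element of `M` is below `z`, then `z` lies in no star and its deletion changes nothing.
    -- Otherwise maximality of `z` puts its whole link, including the centers of the stars, below
    -- `z`.
    rcases (M ∩ Set.Iio z).eq_empty_or_nonempty with hMz | hMz
    · suffices starComplex M D = starComplex M (D \ {z}) by rwa [this]
      ext s
      rw [hstar]
      refine ⟨fun h => ⟨h, fun hzs => ?_⟩, And.left⟩
      obtain ⟨-, -, m, hm, hc⟩ := h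
      have hmem : m ∈ M ∩ Set.Iio z := ⟨hm.1, hcomp m hm.2
        (((isChain_le_insert_iff.1 hc).2 z hzs).symm) (by rintro rfl; exact hzM hm.1)⟩
      simp [hMz] at hmem
    · have hlink : ContractibleSpace (realization (starComplex M (Set.Iio z))) := by
        refine ih _ ?_ (Set.Iio z) (Set.Iio z) (Or.inr ⟨z, hz.prop.2, rfl⟩) hMz
          (isLowerSet_Iio z) Set.sdiff_subset le_rfl rfl
        rw [← hk]
        refine Set.ncard_lt_ncard ⟨fun x hx => ⟨hlt hx.1, hx.2⟩, fun h => ?_⟩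
        exact lt_irrefl z (h hz.prop).1
      refine contractibleSpace_realization_of_deletion_of_link (v := z) hstar (fun s => ?_)
        hdel hlink
      constructor
      · rintro ⟨h1, h2, m, hm, hc⟩
        refine ⟨h1, fun h => lt_irrefl z (h2 h), by simp, ?_, m, ⟨hm.1, hlt hm.2⟩, ?_⟩
        · rw [Finset.coe_insert]
          exact Set.insert_subset hz.prop.1 (h2.trans hlt)
        · rw [Finset.coe_insert, Set.insert_comm, isChain_le_insert_iff]
          refine ⟨hc, ?_⟩
          rintro b (rfl | hb)
          · exact Or.inr (le_of_lt hm.2)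
          · exact Or.inr (le_of_lt (h2 hb))
      · rintro ⟨h1, hzs, -, h2, m, hm, hc⟩
        rw [Finset.coe_insert] at h2 hc
        rw [Set.insert_comm, isChain_le_insert_iff] at hc
        refine ⟨h1, fun x hx => ?_, m, ⟨hm.1, ?_⟩, hc.1⟩
        · exact hcomp x (h2 (Set.mem_insert_of_mem _ hx)) (hc.2 x (Set.mem_insert_of_mem _ hx))
            (by rintro rfl; exact hzs hx)
        · exact hcomp m hm.2 (hc.2 m (Set.mem_insert _ _)) (by rintro rfl; exact hzM hm.1)

end PosetComplexes

/-! ### Orientation of triangles and half-planes. -/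

section Orientation

/-- Twice the signed area of a triangle. -/
def orientation (p q r : ℝ × ℝ) : ℝ :=
  (q.1 - p.1) * (r.2 - p.2) - (q.2 - p.2) * (r.1 - p.1)

theorem orientation_swap_right (p q r : ℝ × ℝ) : orientation p r q = -orientation p q r := by
  unfold orientation; ring

theorem orientation_swap_left (p q r : ℝ × ℝ) : orientation q p r = -orientation p q r := by
  unfold orientation; ring

theorem orientation_rotate (p q r : ℝ × ℝ) : orientation q r p = orientation p q r := by
  unfold orientation; ring

@[simp] theorem orientation_self_right (p q : ℝ × ℝ) : orientation p q q = 0 := by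
  unfold orientation; ring

@[simp] theorem orientation_self_outer (p q : ℝ × ℝ) : orientation p q p = 0 := by
  unfold orientation; ring

theorem orientation_combo (p q x y : ℝ × ℝ) {a b : ℝ} (hab : a + b = 1) :
    orientation p q (a • x + b • y) = a * orientation p q x + b * orientation p q y := by
  obtain rfl : b = 1 - a := by linarith
  simp only [orientation, Prod.fst_add, Prod.snd_add, Prod.smul_fst, Prod.smul_snd, smul_eq_mul]
  ring

theorem convex_orientation_le (p q : ℝ × ℝ) : Convex ℝ {x | orientation p q x ≤ 0} := by
  intro x hx y hy a b ha hb hab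
  simp only [Set.mem_ofPred_eq] at *
  rw [orientation_combo p q x y hab]
  nlinarith

theorem convex_orientation_pos (p q : ℝ × ℝ) : Convex ℝ {x | 0 < orientation p q x} := by
  intro x hx y hy a b ha hb hab
  simp only [Set.mem_ofPred_eq] at *
  rw [orientation_combo p q x y hab]
  rcases ha.eq_or_lt with rfl | ha
  · obtain rfl : b = 1 := by linarith
    simpa using hy
  · have := mul_pos ha hx
    have := mul_nonneg hb hy.le
    linarith

end Orientation

/-! ### Disjoint hulls versus combinatorial noncrossing. -/

namespace ConvexPolygon

variable {n : ℕ} (P : ConvexPolygon n)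

theorem orientation_neg {i j k : Fin (n + 1)} (hij : i < j) (hjk : j < k) :
    orientation (P.vertex i) (P.vertex j) (P.vertex k) < 0 :=
  P.clockwise i j k hij hjk

theorem hull_mono {s t : Set (Fin (n + 1))} (h : s ⊆ t) : P.hull s ⊆ P.hull t :=
  convexHull_mono (Set.image_mono h)

theorem vertex_mem_hull {s : Set (Fin (n + 1))} {a : Fin (n + 1)} (h : a ∈ s) :
    P.vertex a ∈ P.hull s :=
  subset_convexHull ℝ _ (Set.mem_image_of_mem _ h)

theorem orientation_ne_zero {i j k : Fin (n + 1)} (hij : i ≠ j) (hjk : j ≠ k) (hik : i ≠ k) :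
    orientation (P.vertex i) (P.vertex j) (P.vertex k) ≠ 0 := by
  have key : ∀ {i j k}, i < j → j < k →
      orientation (P.vertex i) (P.vertex j) (P.vertex k) ≠ 0 :=
    fun h h' => (P.orientation_neg h h').ne
  rcases lt_or_gt_of_ne hij with h1 | h1 <;> rcases lt_or_gt_of_ne hjk with h2 | h2 <;>
    rcases lt_or_gt_of_ne hik with h3 | h3
  · exact key h1 h2
  · exact absurd (h1.trans h2) h3.asymm
  · rw [← neg_ne_zero, ← orientation_swap_right]; exact key h3 h2
  · rw [← orientation_rotate, ← orientation_rotate]; exact key h3 h1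
  · rw [← neg_ne_zero, ← orientation_swap_left]; exact key h1 h3
  · rw [← orientation_rotate]; exact key h2 h3
  · exact absurd (h2.trans h1) h3.asymm
  · rw [← neg_ne_zero, ← orientation_swap_right, ← orientation_rotate]
    exact key h2 h1

theorem vertex_injective (hn : 2 ≤ n) : Function.Injective P.vertex := by
  intro i j h
  by_contra hij
  obtain ⟨k, hk⟩ : ∃ k, k ∉ ({i, j} : Finset (Fin (n + 1))) := by
    by_contra! hk
    have h1 := Finset.card_le_card fun k (_ : k ∈ Finset.univ) => hk k
    have h2 := Finset.card_le_two (a := i) (b := j)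
    simp only [Finset.card_univ, Fintype.card_fin] at h1
    omega
  simp only [Finset.mem_insert, Finset.mem_singleton, not_or] at hk
  refine P.orientation_ne_zero hk.1 hij hk.2 ?_
  rw [h, orientation_self_right]

theorem not_disjoint_hull_of_crossing {s t : Set (Fin (n + 1))} {a b c d : Fin (n + 1)}
    (hab : a < b) (hbc : b < c) (hcd : c < d) (ha : a ∈ s) (hc : c ∈ s) (hb : b ∈ t)
    (hd : d ∈ t) : ¬ Disjoint (P.hull s) (P.hull t) := by
  have h1 := P.orientation_neg hbc hcd
  have h2 := P.orientation_neg hab (hbc.trans hcd)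
  have h3 := P.orientation_neg (hab.trans hbc) hcd
  have h4 := P.orientation_neg hab hbc
  have hs := P.vertex_mem_hull ha
  have hs' := P.vertex_mem_hull hc
  have ht := P.vertex_mem_hull hb
  have ht' := P.vertex_mem_hull hd
  generalize P.vertex a = A at *
  generalize P.vertex b = B at *
  generalize P.vertex c = C at *
  generalize P.vertex d = D at *
  -- The diagonals `AC` and `BD` meet in a point whose barycentric weights are triangle areas; `w`
  -- is twice the area of the quadrilateral, split along either diagonal.
  set w := -orientation B C D - orientation A B D with hw
  have hwpos : 0 < w := by linarith
  have hw' : w = -orientation A C D - orientation A B C := by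
    rw [hw]; unfold orientation; ring
  rw [Set.not_disjoint_iff]
  refine ⟨(-orientation B C D / w) • A + (-orientation A B D / w) • C, ?_, ?_⟩
  · refine convex_convexHull ℝ _ hs hs' (div_nonneg (by linarith) hwpos.le)
      (div_nonneg (by linarith) hwpos.le) ?_
    rw [← add_div, div_eq_one_iff_eq hwpos.ne']; linarith
  · have : (-orientation B C D / w) • A + (-orientation A B D / w) • C =
        (-orientation A C D / w) • B + (-orientation A B C / w) • D := by
      ext
      · simp only [Prod.fst_add, Prod.smul_fst, smul_eq_mul, div_mul_eq_mul_div, ← add_div]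
        congr 1
        unfold orientation; ring
      · simp only [Prod.snd_add, Prod.smul_snd, smul_eq_mul, div_mul_eq_mul_div, ← add_div]
        congr 1
        unfold orientation; ring
    rw [this]
    refine convex_convexHull ℝ _ ht ht' (div_nonneg (by linarith) hwpos.le)
      (div_nonneg (by linarith) hwpos.le) ?_
    rw [← add_div, div_eq_one_iff_eq hwpos.ne']; linarith

theorem disjoint_hull_of_separated {s t : Set (Fin (n + 1))} (p q : ℝ × ℝ)
    (hs : ∀ x ∈ s, orientation p q (P.vertex x) ≤ 0)
    (ht : ∀ y ∈ t, 0 < orientation p q (P.vertex y)) : Disjoint (P.hull s) (P.hull t) := by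
  have h1 : P.hull s ⊆ {x | orientation p q x ≤ 0} :=
    convexHull_min (by rintro _ ⟨x, hx, rfl⟩; exact hs x hx) (convex_orientation_le p q)
  have h2 : P.hull t ⊆ {x | 0 < orientation p q x} :=
    convexHull_min (by rintro _ ⟨x, hx, rfl⟩; exact ht x hx) (convex_orientation_pos p q)
  refine Set.disjoint_left.2 fun x hxs hxt => ?_
  have hle : orientation p q x ≤ 0 := h1 hxs
  have hlt : 0 < orientation p q x := h2 hxt
  exact absurd hle (not_le.2 hlt)

/-- A line through two vertices of one of the sets separates them: all of `t` lies in a single gap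
of `s` in the cyclic order, and the line spans that gap. If `s` is a single vertex, the extreme
vertices of `t` are used instead. -/
theorem disjoint_hull_of_noncrossing_of_lt (hn : 2 ≤ n) {s t : Finset (Fin (n + 1))}
    {a₀ : Fin (n + 1)} (ha₀ : a₀ ∈ s) (hat : ∀ y ∈ t, a₀ < y) (hst : Disjoint s t)
    (h : ∀ a ∈ s, ∀ b ∈ t, ∀ c ∈ s, ∀ d ∈ t, a < b → b < c → ¬ c < d) :
    Disjoint (P.hull s) (P.hull t) := by
  rcases t.eq_empty_or_nonempty with rfl | htne
  · simp [hull]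
  have hne : ∀ x ∈ s, ∀ y ∈ t, x ≠ y := fun x hx y hy => Finset.disjoint_iff_ne.1 hst x hx y hy
  have hneg : ∀ i j k : Fin (n + 1), i ≤ j → j ≤ k →
      orientation (P.vertex i) (P.vertex j) (P.vertex k) ≤ 0 := by
    intro i j k hij hjk
    rcases hij.eq_or_lt with rfl | hij
    · rw [← orientation_rotate]; simp
    rcases hjk.eq_or_lt with rfl | hjk
    · simp
    · exact (P.orientation_neg hij hjk).le
  obtain ⟨b, hb, hbmin⟩ := t.exists_min_image id htne
  obtain ⟨r, hr, hrmax⟩ := t.exists_max_image id htne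
  simp only [id] at hbmin hrmax
  by_cases hex : ∃ c ∈ s, b < c
  · obtain ⟨a, ha, hamax⟩ := (s.filter (· < b)).exists_max_image id
      ⟨a₀, by simp [ha₀, hat b hb]⟩
    obtain ⟨c, hc, hcmin⟩ := (s.filter (b < ·)).exists_min_image id
      (by obtain ⟨c, hc, hbc⟩ := hex; exact ⟨c, by simp [hc, hbc]⟩)
    simp only [Finset.mem_filter, id] at ha hamax hc hcmin
    -- The gap of `s` containing `b` runs from `a` to `c`, and noncrossing keeps the rest of `t`
    -- inside it.
    refine P.disjoint_hull_of_separated (P.vertex a) (P.vertex c) (fun x hx => ?_) fun y hy => ?_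
    · rcases lt_or_gt_of_ne (hne x hx b hb) with hxb | hxb
      · have := hneg x a c (hamax x ⟨hx, hxb⟩) (ha.2.trans hc.2).le
        rwa [← orientation_rotate] at this
      · exact hneg a c x (ha.2.trans hc.2).le (hcmin x ⟨hx, hxb⟩)
    · have hyc : y < c := by
        refine lt_of_le_of_ne (not_lt.1 (h a ha.1 b hb c hc.1 y hy ha.2 hc.2)) ?_
        exact (hne c hc.1 y hy).symm
      have := P.orientation_neg (ha.2.trans_le (hbmin y hy)) hyc
      rw [orientation_swap_right]
      linarith
  · push Not at hex
    have hlt : ∀ x ∈ s, ∀ y ∈ t, x < y := fun x hx y hy =>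
      lt_of_lt_of_le (lt_of_le_of_ne (hex x hx) (hne x hx b hb)) (hbmin y hy)
    obtain ⟨p, hp, hpmin⟩ := s.exists_min_image id ⟨a₀, ha₀⟩
    obtain ⟨q, hq, hqmax⟩ := s.exists_max_image id ⟨a₀, ha₀⟩
    simp only [id] at hpmin hqmax
    rcases (hpmin q hq).eq_or_lt with rfl | hpq
    · obtain rfl : s = {p} := Finset.eq_singleton_iff_unique_mem.2
        ⟨hp, fun x hx => le_antisymm (hqmax x hx) (hpmin x hx)⟩
      rcases (hbmin r hr).eq_or_lt with rfl | hbr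
      · obtain rfl : t = {b} := Finset.eq_singleton_iff_unique_mem.2
          ⟨hb, fun x hx => le_antisymm (hrmax x hx) (hbmin x hx)⟩
        have := (P.vertex_injective hn).ne (hne p hp b hb)
        simpa [hull] using this
      · refine (P.disjoint_hull_of_separated (P.vertex r) (P.vertex b) (fun y hy => ?_)
          fun x hx => ?_).symm
        · have := hneg b y r (hbmin y hy) (hrmax y hy)
          rw [← orientation_rotate, ← orientation_rotate] at this
          exact this
        · have := P.orientation_neg (hlt x hx b hb) hbr
          rw [orientation_swap_left, orientation_rotate]
          linarith
    · refine P.disjoint_hull_of_separated (P.vertex q) (P.vertex p) (fun x hx => ?_)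
        fun y hy => ?_
      · have := hneg p x q (hpmin x hx) (hqmax x hx)
        rw [← orientation_rotate, ← orientation_rotate] at this
        exact this
      · have := P.orientation_neg hpq (hlt q hq y hy)
        rw [orientation_swap_left]
        linarith

theorem disjoint_hull_of_noncrossing (hn : 2 ≤ n) {s t : Finset (Fin (n + 1))}
    (hst : Disjoint s t)
    (h : ∀ a ∈ s, ∀ b ∈ t, ∀ c ∈ s, ∀ d ∈ t, a < b → b < c → ¬ c < d)
    (h' : ∀ a ∈ t, ∀ b ∈ s, ∀ c ∈ t, ∀ d ∈ s, a < b → b < c → ¬ c < d) :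
    Disjoint (P.hull s) (P.hull t) := by
  rcases s.eq_empty_or_nonempty with rfl | hs
  · simp [hull]
  rcases t.eq_empty_or_nonempty with rfl | ht
  · simp [hull]
  obtain ⟨a, ha, hamin⟩ := s.exists_min_image id hs
  obtain ⟨b, hb, hbmin⟩ := t.exists_min_image id ht
  simp only [id] at hamin hbmin
  rcases lt_or_gt_of_ne (Finset.disjoint_iff_ne.1 hst a ha b hb) with hab | hab
  · exact P.disjoint_hull_of_noncrossing_of_lt hn ha (fun y hy => hab.trans_le (hbmin y hy)) hst h
  · exact (P.disjoint_hull_of_noncrossing_of_lt hn hb (fun y hy => hab.trans_le (hamin y hy))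
      hst.symm h').symm

theorem hull_pair_inter_hull_pair {a c d : Fin (n + 1)} (hac : a ≠ c) (had : a ≠ d)
    (hcd : c ≠ d) : P.hull {a, c} ∩ P.hull {a, d} = {P.vertex a} := by
  refine Set.Subset.antisymm ?_ ?_
  · rintro x ⟨h1, h2⟩
    have h1 : x ∈ {x | orientation (P.vertex a) (P.vertex c) x ≤ 0} := by
      refine convexHull_min ?_ (convex_orientation_le _ _) h1
      rintro _ ⟨y, rfl | rfl, rfl⟩ <;> simp
    have h1' : x ∈ {x | orientation (P.vertex c) (P.vertex a) x ≤ 0} := by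
      refine convexHull_min ?_ (convex_orientation_le _ _) ‹x ∈ P.hull {a, c}›
      rintro _ ⟨y, rfl | rfl, rfl⟩ <;> simp
    simp only [Set.mem_ofPred_eq] at h1 h1'
    rw [orientation_swap_left] at h1'
    simp only [hull, Set.image_pair, convexHull_pair] at h2
    obtain ⟨u, v, hu, hv, huv, rfl⟩ := h2
    rw [orientation_combo _ _ _ _ huv, orientation_self_outer] at h1 h1'
    have h0 : v * orientation (P.vertex a) (P.vertex c) (P.vertex d) = 0 := by linarith
    rcases mul_eq_zero.1 h0 with rfl | h0
    · obtain rfl : u = 1 := by linarith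
      simp
    · exact absurd h0 (P.orientation_ne_zero hac hcd had)
  · rintro _ rfl
    exact ⟨P.vertex_mem_hull (by simp), P.vertex_mem_hull (by simp)⟩

/-- No block of the partition crosses another one, in terms of the linear order of the labels. -/
def _root_.Finpartition.IsNoncrossing
    (p : Finpartition (Finset.univ : Finset (Fin (n + 1)))) : Prop :=
  ∀ a b c d : Fin (n + 1), a < b → b < c → c < d → p.part a = p.part c → p.part b = p.part d →
    p.part a = p.part b

theorem disjoint_hull_parts_iff_isNoncrossing (hn : 2 ≤ n)
    (p : Finpartition (Finset.univ : Finset (Fin (n + 1)))) :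
    (∀ s ∈ p.parts, ∀ t ∈ p.parts, s ≠ t → Disjoint (P.hull s) (P.hull t)) ↔
      p.IsNoncrossing := by
  have hpart : ∀ a, a ∈ p.part a := fun a => p.mem_part (Finset.mem_univ a)
  constructor
  · intro h a b c d hab hbc hcd hac hbd
    by_contra hne
    exact P.not_disjoint_hull_of_crossing hab hbc hcd (Finset.mem_coe.2 (hpart a))
      (Finset.mem_coe.2 (hac ▸ hpart c)) (Finset.mem_coe.2 (hpart b))
      (Finset.mem_coe.2 (hbd ▸ hpart d))
      (h _ (p.part_mem.2 (Finset.mem_univ a)) _ (p.part_mem.2 (Finset.mem_univ b)) hne)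
  · intro h s hs t ht hst
    have key : ∀ s ∈ p.parts, ∀ t ∈ p.parts, s ≠ t → ∀ a ∈ s, ∀ b ∈ t, ∀ c ∈ s, ∀ d ∈ t,
        a < b → b < c → ¬ c < d := by
      intro s hs t ht hst a ha b hb c hc d hd hab hbc hcd
      have hpa := p.part_eq_of_mem hs ha
      have hpb := p.part_eq_of_mem ht hb
      refine hst ?_
      rw [← hpa, ← hpb]
      exact h a b c d hab hbc hcd (hpa.trans (p.part_eq_of_mem hs hc).symm)
        (hpb.trans (p.part_eq_of_mem ht hd).symm)
    exact P.disjoint_hull_of_noncrossing hn (p.disjoint hs ht hst) (key s hs t ht hst)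
      (key t ht s hs hst.symm)

end ConvexPolygon

/-! ### Merging two blocks of a partition. -/

namespace Finpartition

section Merge

variable {V : Type*} [Fintype V] [DecidableEq V] {p q : Finpartition (Finset.univ : Finset V)}

theorem mem_part_iff_part_eq {a b : V} : a ∈ p.part b ↔ p.part a = p.part b :=
  p.mem_part_iff_part_eq_part (Finset.mem_univ a) (Finset.mem_univ b)

theorem le_iff_part_eq : p ≤ q ↔ ∀ a b, p.part a = p.part b → q.part a = q.part b := by
  constructor
  · intro h a b hab
    obtain ⟨t, ht, hpt⟩ := h (p.part_mem.2 (Finset.mem_univ a))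
    rw [q.part_eq_of_mem ht (hpt (p.mem_part (Finset.mem_univ a))),
      q.part_eq_of_mem ht (hpt (hab ▸ p.mem_part (Finset.mem_univ b)))]
  · intro h s hs
    obtain ⟨a, ha⟩ := p.nonempty_of_mem_parts hs
    refine ⟨q.part a, q.part_mem.2 (Finset.mem_univ a), fun b hb => ?_⟩
    rw [mem_part_iff_part_eq]
    exact h b a ((p.part_eq_of_mem hs hb).trans (p.part_eq_of_mem hs ha).symm)

theorem part_bot_eq_part_bot_iff {a b : V} :
    (⊥ : Finpartition (Finset.univ : Finset V)).part a =
      (⊥ : Finpartition (Finset.univ : Finset V)).part b ↔ a = b := by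
  refine ⟨fun h => ?_, fun h => h ▸ rfl⟩
  have : ∀ c : V, (⊥ : Finpartition (Finset.univ : Finset V)).part c = {c} := fun c =>
    part_eq_of_mem _ (mem_bot_iff.2 ⟨c, Finset.mem_univ c, rfl⟩) (Finset.mem_singleton_self c)
  simpa [this] using h

/-- The equivalence relation that joins the blocks of `u` and `v` to a single class. -/
def mergeSetoid (p : Finpartition (Finset.univ : Finset V)) (u v : V) : Setoid V where
  r a b := p.part a = p.part b ∨ (p.part a = p.part u ∨ p.part a = p.part v) ∧
    (p.part b = p.part u ∨ p.part b = p.part v)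
  iseqv :=
    { refl := fun _ => Or.inl rfl
      symm := fun h => h.imp Eq.symm And.symm
      trans := by
        rintro a b c (h1 | h1) (h2 | h2)
        · exact Or.inl (h1.trans h2)
        · exact Or.inr (by rwa [h1])
        · exact Or.inr (by rwa [← h2])
        · exact Or.inr ⟨h1.1, h2.2⟩ }

instance (p : Finpartition (Finset.univ : Finset V)) (u v : V) :
    DecidableRel (p.mergeSetoid u v) :=
  fun a b => inferInstanceAs (Decidable (p.part a = p.part b ∨
    (p.part a = p.part u ∨ p.part a = p.part v) ∧ (p.part b = p.part u ∨ p.part b = p.part v)))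

/-- The partition obtained by joining the blocks of `u` and `v` to a single block. -/
def merge (p : Finpartition (Finset.univ : Finset V)) (u v : V) :
    Finpartition (Finset.univ : Finset V) :=
  ofSetoid (p.mergeSetoid u v)

theorem part_merge_eq_iff {u v a b : V} :
    (p.merge u v).part a = (p.merge u v).part b ↔ p.part a = p.part b ∨
      (p.part a = p.part u ∨ p.part a = p.part v) ∧
      (p.part b = p.part u ∨ p.part b = p.part v) := by
  rw [eq_comm, ← mem_part_iff_part_eq]
  exact mem_part_ofSetoid_iff_rel

theorem le_merge (u v : V) : p ≤ p.merge u v :=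
  le_iff_part_eq.2 fun _ _ h => part_merge_eq_iff.2 (Or.inl h)

theorem part_merge_eq (u v : V) : (p.merge u v).part u = (p.merge u v).part v :=
  part_merge_eq_iff.2 (Or.inr ⟨Or.inl rfl, Or.inr rfl⟩)

theorem merge_le {u v : V} (h : p ≤ q) (huv : q.part u = q.part v) : p.merge u v ≤ q := by
  rw [le_iff_part_eq] at h ⊢
  intro a b hab
  rcases part_merge_eq_iff.1 hab with hab | ⟨ha, hb⟩
  · exact h a b hab
  · have key : ∀ c, p.part c = p.part u ∨ p.part c = p.part v → q.part c = q.part u := by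
      rintro c (hc | hc)
      · exact h c u hc
      · exact (h c v hc).trans huv.symm
    exact (key a ha).trans (key b hb).symm

theorem card_parts_merge {u v : V} (huv : p.part u ≠ p.part v) :
    (p.merge u v).parts.card + 1 = p.parts.card := by
  have hu : p.part u ∈ p.parts := p.part_mem.2 (Finset.mem_univ u)
  have hv : p.part v ∈ p.parts := p.part_mem.2 (Finset.mem_univ v)
  have hself : ∀ a, a ∈ p.part a := fun a => p.mem_part (Finset.mem_univ a)
  have h1 : (p.merge u v).parts =
      insert (p.part u ∪ p.part v) ((p.parts.erase (p.part u)).erase (p.part v)) := by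
    have hpart : ∀ a, (p.merge u v).part a =
        if p.part a = p.part u ∨ p.part a = p.part v then p.part u ∪ p.part v else p.part a := by
      intro a
      ext b
      rw [mem_part_iff_part_eq, part_merge_eq_iff]
      split_ifs with h
      · simp only [Finset.mem_union, mem_part_iff_part_eq]
        rcases h with h | h <;> simp only [h] <;> tauto
      · simp [h, mem_part_iff_part_eq]
    have hrange : ∀ (r : Finpartition (Finset.univ : Finset V)) (t : Finset V),
        t ∈ r.parts ↔ ∃ a, r.part a = t := by
      intro r t
      constructor
      · intro ht
        obtain ⟨a, ha⟩ := r.nonempty_of_mem_parts ht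
        exact ⟨a, r.part_eq_of_mem ht ha⟩
      · rintro ⟨a, rfl⟩
        exact r.part_mem.2 (Finset.mem_univ a)
    ext t
    simp only [hrange, hpart, Finset.mem_insert, Finset.mem_erase]
    constructor
    · rintro ⟨a, rfl⟩
      split_ifs with h
      · exact Or.inl rfl
      · push Not at h
        exact Or.inr ⟨h.2, h.1, a, rfl⟩
    · rintro (rfl | ⟨h1, h2, a, rfl⟩)
      · exact ⟨u, by simp⟩
      · exact ⟨a, by simp [h1, h2]⟩
  have h2 : p.part u ∪ p.part v ∉ (p.parts.erase (p.part u)).erase (p.part v) := by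
    intro h
    simp only [Finset.mem_erase] at h
    have := p.part_eq_of_mem h.2.2 (Finset.mem_union_left _ (hself u))
    exact h.2.1 this.symm
  have h3 : p.part v ∈ p.parts.erase (p.part u) := Finset.mem_erase.2 ⟨huv.symm, hv⟩
  rw [h1, Finset.card_insert_of_notMem h2, Finset.card_erase_of_mem h3, Finset.card_erase_of_mem hu]
  have := Finset.card_pos.2 ⟨_, h3⟩
  rw [Finset.card_erase_of_mem hu] at this
  omega

end Merge

end Finpartition

/-! ### Clockwise distance and the next vertex of a block. -/

section CyclicDistance

variable {n : ℕ}

/-- The number of clockwise steps, between `1` and `n + 1`, that lead from `v` to `w`. -/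
def cyclicDist (v w : Fin (n + 1)) : ℕ :=
  if (v : ℕ) < w then w - v else w + (n + 1) - v

theorem val_finRotate_pow (k : ℕ) (v : Fin (n + 1)) :
    ((finRotate (n + 1) ^ k) v : ℕ) = (v + k) % (n + 1) := by
  induction k with
  | zero => simp [Nat.mod_eq_of_lt v.2]
  | succ k ih =>
    rw [pow_succ', Equiv.Perm.mul_apply, finRotate_apply, Fin.val_add, ih, Fin.val_one',
      ← Nat.add_mod, add_assoc]

theorem cyclicDist_pos (v w : Fin (n + 1)) : 0 < cyclicDist v w := by
  unfold cyclicDist; split_ifs <;> omega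

theorem cyclicDist_le (v w : Fin (n + 1)) : cyclicDist v w ≤ n + 1 := by
  unfold cyclicDist; split_ifs <;> omega

theorem finRotate_pow_cyclicDist (v w : Fin (n + 1)) :
    (finRotate (n + 1) ^ cyclicDist v w) v = w := by
  have hv := v.2
  have hw := w.2
  ext
  rw [val_finRotate_pow]
  unfold cyclicDist
  split_ifs with h
  · rw [Nat.add_sub_of_le h.le, Nat.mod_eq_of_lt hw]
  · rw [show (v : ℕ) + (w + (n + 1) - v) = w + (n + 1) by omega, Nat.add_mod_right,
      Nat.mod_eq_of_lt hw]

theorem cyclicDist_finRotate_pow (v : Fin (n + 1)) {k : ℕ} (hk : 0 < k) (hk' : k ≤ n + 1) :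
    cyclicDist v ((finRotate (n + 1) ^ k) v) = k := by
  have hv := v.2
  unfold cyclicDist
  rw [val_finRotate_pow]
  rcases lt_or_ge ((v : ℕ) + k) (n + 1) with h | h
  · rw [Nat.mod_eq_of_lt h, if_pos (by omega)]; omega
  · rw [Nat.mod_eq_sub_mod h, Nat.mod_eq_of_lt (by omega), if_neg (by omega)]; omega

theorem cyclicDist_finRotate (hn : 1 ≤ n) (v : Fin (n + 1)) :
    cyclicDist v (finRotate (n + 1) v) = 1 := by
  simpa using cyclicDist_finRotate_pow v one_pos (by omega)

/-- The value is a full turn, not `0`: a vertex is the last candidate for its own successor, chosen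
only in a singleton block. -/
theorem cyclicDist_self (v : Fin (n + 1)) : cyclicDist v v = n + 1 := by
  unfold cyclicDist; rw [if_neg (by omega)]; omega

variable {p : Finpartition (Finset.univ : Finset (Fin (n + 1)))}

theorem nextVertex_eq_of_forall_le {v w : Fin (n + 1)} (hw : p.part w = p.part v)
    (h : ∀ u, p.part u = p.part v → cyclicDist v w ≤ cyclicDist v u) : nextVertex p v = w := by
  have hspec := Nat.find_spec (exists_pos_finRotate_pow_mem_part p v)
  have hle : stepsToNext p v ≤ cyclicDist v w := by
    refine Nat.find_min' (exists_pos_finRotate_pow_mem_part p v) ⟨cyclicDist_pos v w, ?_⟩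
    rw [finRotate_pow_cyclicDist]
    exact Finpartition.mem_part_iff_part_eq.2 hw
  have h1 := h _ (Finpartition.mem_part_iff_part_eq.1 hspec.2)
  have h2 := cyclicDist_finRotate_pow v hspec.1 (hle.trans (cyclicDist_le v w))
  have : stepsToNext p v = cyclicDist v w := le_antisymm hle (h1.trans h2.le)
  rw [nextVertex, this, finRotate_pow_cyclicDist]

theorem nextVertex_spec (p : Finpartition (Finset.univ : Finset (Fin (n + 1))))
    (v : Fin (n + 1)) : p.part (nextVertex p v) = p.part v ∧
      ∀ u, p.part u = p.part v → cyclicDist v (nextVertex p v) ≤ cyclicDist v u := by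
  obtain ⟨w, hw, hmin⟩ := (p.part v).exists_min_image (cyclicDist v)
    ⟨v, p.mem_part (Finset.mem_univ v)⟩
  simp only [Finpartition.mem_part_iff_part_eq] at hw hmin
  rw [nextVertex_eq_of_forall_le hw hmin]
  exact ⟨hw, hmin⟩

theorem part_nextVertex (p : Finpartition (Finset.univ : Finset (Fin (n + 1))))
    (v : Fin (n + 1)) : p.part (nextVertex p v) = p.part v :=
  (nextVertex_spec p v).1

theorem cyclicDist_nextVertex_le {v u : Fin (n + 1)} (h : p.part u = p.part v) :
    cyclicDist v (nextVertex p v) ≤ cyclicDist v u :=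
  (nextVertex_spec p v).2 u h

theorem nextVertex_bijective (p : Finpartition (Finset.univ : Finset (Fin (n + 1)))) :
    Function.Bijective (nextVertex p) :=
  Finite.injective_iff_bijective.1 (nextVertex_injective p)

theorem blockPerm_apply (v : Fin (n + 1)) : blockPerm p v = nextVertex p v := rfl

end CyclicDistance

/-! ### Noncrossing partitions: merges and block permutations. -/

namespace Finpartition

variable {n : ℕ} {p q : Finpartition (Finset.univ : Finset (Fin (n + 1)))}

/-- Noncrossing is invariant under rotation, although its definition uses the linear order that
starts at vertex `0`. -/
theorem IsNoncrossing.part_eq_of_cyclicDist_lt (hp : p.IsNoncrossing) {a b c d : Fin (n + 1)}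
    (hbc : cyclicDist a b < cyclicDist a c) (hcd : cyclicDist a c < cyclicDist a d)
    (hac : p.part a = p.part c) (hbd : p.part b = p.part d) : p.part a = p.part b := by
  rcases eq_or_ne a d with rfl | had
  · exact hbd.symm
  have had' : (a : ℕ) ≠ d := fun h => had (Fin.ext h)
  have ha := a.2
  have hb := b.2
  have hc := c.2
  have hd := d.2
  unfold cyclicDist at hbc hcd
  by_cases h1 : (a : ℕ) < b <;> by_cases h2 : (a : ℕ) < c <;> by_cases h3 : (a : ℕ) < d <;>
    simp only [h1, h2, h3, if_true, if_false] at hbc hcd <;> try omega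
  · exact hp a b c d (by omega) (by omega) (by omega) hac hbd
  · exact (hp d a b c (by omega) (by omega) (by omega) hbd.symm hac).symm.trans hbd.symm
  · exact hac.trans ((hp c d a b (by omega) (by omega) (by omega) hac.symm hbd.symm).trans hbd.symm)
  · exact (hac.trans (hp b c d a (by omega) (by omega) (by omega) hbd hac.symm).symm)

theorem isNoncrossing_bot :
    (⊥ : Finpartition (Finset.univ : Finset (Fin (n + 1)))).IsNoncrossing := by
  intro a b c d hab hbc _ hac _
  rw [part_bot_eq_part_bot_iff] at hac
  exact absurd hac (hab.trans hbc).ne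

/-- A chord of one block has each other block entirely on one side. -/
theorem IsNoncrossing.mem_Ioo_iff (hp : p.IsNoncrossing) {a u c d : Fin (n + 1)}
    (hau : p.part a = p.part u) (hcd : p.part c = p.part d) (hne : p.part c ≠ p.part u) :
    c < a ∧ a < d ↔ c < u ∧ u < d := by
  have key : ∀ {x y : Fin (n + 1)}, p.part x = p.part y → p.part c ≠ p.part y → c < x ∧ x < d →
      c < y ∧ y < d := by
    intro x y hxy hne ⟨h1, h2⟩
    rcases lt_trichotomy c y with h | rfl | h
    · refine ⟨h, ?_⟩
      rcases lt_trichotomy y d with h' | rfl | h'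
      · exact h'
      · exact absurd hcd hne
      · exact absurd (hp c x d y h1 h2 h' hcd hxy) (by rwa [hxy])
    · exact absurd rfl hne
    · exact absurd (hp y c x d h h1 h2 hxy.symm hcd).symm hne
  exact ⟨key hau hne, key hau.symm (by rwa [hau])⟩

/-- Two blocks of a noncrossing partition that are consecutive in a block of a coarser one can be
merged. -/
theorem IsNoncrossing.merge_nextVertex (hp : p.IsNoncrossing) (hq : q.IsNoncrossing)
    (hpq : p ≤ q) (u : Fin (n + 1)) : (p.merge u (nextVertex q u)).IsNoncrossing := by
  obtain ⟨hv, hmin⟩ := nextVertex_spec q u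
  generalize nextVertex q u = v at hv hmin
  -- A third `p`-block cannot separate `u` from `v`: one of its vertices would lie strictly between
  -- them, and noncrossing of `q` would put that vertex into their `q`-block, although `v` is the
  -- next vertex after `u`.
  have hsep : ∀ c d, p.part c = p.part d → p.part c ≠ p.part u → p.part c ≠ p.part v →
      ¬ (cyclicDist u c < cyclicDist u v ∧ cyclicDist u v < cyclicDist u d) := by
    rintro c d hcd hcu hcv ⟨h1, h2⟩
    have := hq.part_eq_of_cyclicDist_lt h1 h2 hv.symm (le_iff_part_eq.1 hpq _ _ hcd)
    exact absurd (hmin c this.symm) (not_le.2 h1)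
  have hsep' : ∀ c d, p.part c = p.part d → p.part c ≠ p.part u → p.part c ≠ p.part v →
      (c < u ∧ u < d ↔ c < v ∧ v < d) := by
    intro c d hcd hcu hcv
    have h1 := hsep c d hcd hcu hcv
    have h2 := hsep d c hcd.symm (hcd ▸ hcu) (hcd ▸ hcv)
    have n1 : (c : ℕ) ≠ u := fun h => hcu (by rw [Fin.ext h])
    have n2 : (c : ℕ) ≠ v := fun h => hcv (by rw [Fin.ext h])
    have n3 : (d : ℕ) ≠ u := fun h => hcu (by rw [hcd, Fin.ext h])
    have n4 : (d : ℕ) ≠ v := fun h => hcv (by rw [hcd, Fin.ext h])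
    have := u.2
    have := v.2
    have := c.2
    have := d.2
    simp only [cyclicDist, Fin.lt_def] at h1 h2 ⊢
    split_ifs at h1 h2 <;> omega
  have hmem : ∀ {a b c}, p.part a = p.part u ∨ p.part a = p.part v → p.part b = p.part c →
      p.part b ≠ p.part u → p.part b ≠ p.part v → (b < a ∧ a < c ↔ b < u ∧ u < c) := by
    rintro a b c (ha | ha) hbc hbu hbv
    · exact hp.mem_Ioo_iff ha hbc hbu
    · rw [hp.mem_Ioo_iff ha hbc hbv, hsep' b c hbc hbu hbv]
  intro a b c d hab hbc hcd hac hbd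
  rw [part_merge_eq_iff] at hac hbd ⊢
  rcases hac with hac | ⟨ha, hc⟩
  · rcases hbd with hbd | ⟨hb, hd⟩
    · exact Or.inl (hp a b c d hab hbc hcd hac hbd)
    · by_cases h : p.part a = p.part u ∨ p.part a = p.part v
      · exact Or.inr ⟨h, hb⟩
      · push Not at h
        have h1 := (hmem hb hac h.1 h.2).1 ⟨hab, hbc⟩
        have h2 := (hmem hd hac h.1 h.2).2 h1
        exact absurd hcd h2.2.asymm
  · by_cases h : p.part b = p.part u ∨ p.part b = p.part v
    · exact Or.inr ⟨ha, h⟩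
    · rcases hbd with hbd | hbd
      · push Not at h
        have h1 := (hmem hc hbd h.1 h.2).1 ⟨hbc, hcd⟩
        have h2 := (hmem ha hbd h.1 h.2).2 h1
        exact absurd hab h2.1.asymm
      · exact absurd hbd.1 h

/-- Among the pairs joined by `q` but not by `p`, one at least clockwise distance is consecutive in
its `q`-block; otherwise the successor of its first vertex would give a closer pair. -/
theorem exists_part_nextVertex_ne (hpq : p < q) : ∃ u, p.part u ≠ p.part (nextVertex q u) := by
  have hne : ∃ k a b, q.part a = q.part b ∧ p.part a ≠ p.part b ∧ cyclicDist a b = k := by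
    by_contra! h
    exact hpq.not_ge (le_iff_part_eq.2 fun a b hab => by
      by_contra hp
      exact h _ a b hab hp rfl)
  classical
  obtain ⟨a, b, hab, hne', hk⟩ := Nat.find_spec hne
  have hmin := fun m hm => Nat.find_min hne (m := m) hm
  refine ⟨a, fun h => ?_⟩
  have hle := cyclicDist_nextVertex_le (p := q) hab.symm
  rw [← hk] at hmin
  set c := nextVertex q a with hc
  have hcb : c ≠ b := by
    intro hcb
    rw [hcb] at h
    exact hne' h
  have hlt : cyclicDist c b < cyclicDist a b := by
    have h1 : (c : ℕ) ≠ b := fun h => hcb (Fin.ext h)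
    have h2 : (a : ℕ) ≠ b := fun h => hne' (by rw [Fin.ext h])
    have := a.2
    have := b.2
    have := c.2
    unfold cyclicDist at hle ⊢
    split_ifs at hle ⊢ <;> omega
  exact hmin _ hlt ⟨c, b, (part_nextVertex q a).trans hab, fun h' => hne' (h.trans h'), rfl⟩

/-- Left multiplication by the transposition splices two cycles: `u` now goes to `v`, and `w`, which
preceded `v`, goes to the old successor of `u`. All other successors stay, since the block of `v`
occupies the gap right after `u`. -/
theorem blockPerm_merge (hp : p.IsNoncrossing) {u w : Fin (n + 1)}
    (hq : q = p.merge u (nextVertex q u)) (huv : p.part u ≠ p.part (nextVertex q u))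
    (hw : nextVertex p w = nextVertex q u) :
    blockPerm q = Equiv.swap (nextVertex p u) (nextVertex q u) * blockPerm p := by
  obtain ⟨hv, hmin⟩ := nextVertex_spec q u
  have hpw : p.part w = p.part (nextVertex q u) := by rw [← hw, part_nextVertex]
  generalize nextVertex q u = v at *
  have hpart : ∀ a b, q.part a = q.part b ↔ p.part a = p.part b ∨
      (p.part a = p.part u ∨ p.part a = p.part v) ∧
      (p.part b = p.part u ∨ p.part b = p.part v) := by
    intro a b
    rw [hq]
    exact part_merge_eq_iff
  have hagree : ∀ x, x ≠ w → nextVertex q x = Equiv.swap (nextVertex p u) v (nextVertex p x) := by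
    intro x hxw
    have hcv : nextVertex p x ≠ v := fun h => hxw (nextVertex_injective p (h.trans hw.symm))
    rcases eq_or_ne x u with rfl | hxu
    · rw [Equiv.swap_apply_left]
      exact nextVertex_eq_of_forall_le hv hmin
    rw [Equiv.swap_apply_of_ne_of_ne (fun h => hxu (nextVertex_injective p h)) hcv]
    obtain ⟨hc, hcmin⟩ := nextVertex_spec p x
    generalize nextVertex p x = c at *
    refine nextVertex_eq_of_forall_le ((hpart _ _).2 (Or.inl hc)) fun y hy => ?_
    have hu := u.2
    have hv' := v.2
    have hx := x.2
    have hc' := c.2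
    have n1 : (x : ℕ) ≠ u := fun h => hxu (Fin.ext h)
    have n2 : (c : ℕ) ≠ v := fun h => hcv (Fin.ext h)
    have n3 : (u : ℕ) ≠ v := fun h => huv (by rw [Fin.ext h])
    rcases (hpart _ _).1 hy with hy | ⟨hy | hy, hx | hx⟩
    · exact hcmin y hy
    · exact hcmin y (hy.trans hx.symm)
    · by_contra! hlt
      -- Since `p` is noncrossing, `u` comes before the successor `c` of `x`. As `v` is first after
      -- `u` and `c` first after `x`, the two would coincide.
      have h1 : cyclicDist x u ≤ cyclicDist x c := by
        by_contra! h
        refine huv ?_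
        rw [← hy, ← hx]
        exact (hp.part_eq_of_cyclicDist_lt hlt h hc.symm hy).symm
      have h2 := hcmin v hx.symm
      have h3 := hmin c ((hpart _ _).2 (Or.inr ⟨Or.inr (hc.trans hx), Or.inl rfl⟩))
      have n4 : (c : ℕ) ≠ u := fun h => huv (by rw [← Fin.ext h, hc, hx])
      unfold cyclicDist at h1 h2 h3
      split_ifs at h1 h2 h3 <;> omega
    · by_contra! hlt
      have h1 : cyclicDist x v ≤ cyclicDist x c := by
        by_contra! h
        refine huv ?_
        rw [← hy, ← hx]
        exact hp.part_eq_of_cyclicDist_lt hlt h hc.symm hy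
      have h2 := hcmin u hx.symm
      have h3 := hmin x ((hpart _ _).2 (Or.inl hx))
      have n4 : (x : ℕ) ≠ v := fun h => huv (by rw [← Fin.ext h, hx])
      unfold cyclicDist at h1 h2 h3
      split_ifs at h1 h2 h3 <;> omega
    · exact hcmin y (hy.trans hx.symm)
  refine Equiv.ext fun x => ?_
  -- Two bijections that agree away from `w` also agree at `w`.
  rcases eq_or_ne x w with rfl | hxw
  · obtain ⟨y, hy⟩ := (blockPerm q).surjective
      ((Equiv.swap (nextVertex p u) v * blockPerm p) x)
    rcases eq_or_ne y x with rfl | hyx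
    · exact hy
    · exact absurd ((Equiv.swap (nextVertex p u) v * blockPerm p).injective
        ((hagree y hyx).symm.trans hy)) hyx
  · exact hagree x hxw

end Finpartition

/-! ### Auxiliary facts on cyclic order and transpositions. -/

theorem cyclicDist_lt_of_consecutive {n : ℕ} {u a b c : Fin (n + 1)} (hab : a ≠ b) (hca : c ≠ a)
    (hb : cyclicDist u b ≤ cyclicDist u a) (ha : cyclicDist u a ≤ cyclicDist u c) :
    cyclicDist a c < cyclicDist a b := by
  have h1 : (a : ℕ) ≠ b := fun h => hab (Fin.ext h)
  have h2 : (c : ℕ) ≠ a := fun h => hca (Fin.ext h)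
  have := u.2
  have := a.2
  have := b.2
  have := c.2
  unfold cyclicDist at *
  split_ifs at * <;> omega

theorem prod_reverse_ofFn_div {G : Type*} [Group G] {n : ℕ} (g : Fin (n + 1) → G) :
    (List.ofFn fun i : Fin n => g i.succ * (g i.castSucc)⁻¹).reverse.prod =
      g (Fin.last n) * (g 0)⁻¹ := by
  induction n with
  | zero => simp
  | succ n ih =>
    have := ih fun i => g i.succ
    rw [List.ofFn_succ, List.reverse_cons, List.prod_append, List.prod_singleton]
    simp only [Fin.succ_castSucc] at this
    rw [this]
    simp

theorem Equiv.swap_eq_swap_cases {V : Type*} [DecidableEq V] {a b c d : V} (hab : a ≠ b)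
    (h : Equiv.swap a b = Equiv.swap c d) : a = c ∧ b = d ∨ a = d ∧ b = c := by
  have h1 := congrArg (fun σ => σ a) h
  simp only [Equiv.swap_apply_left, Equiv.swap_apply_def] at h1
  split_ifs at h1 with h2 h3
  · exact Or.inl ⟨h2, h1⟩
  · exact Or.inr ⟨h3, h1⟩
  · exact absurd h1.symm hab

theorem edgeSwap_mk {V : Type*} [DecidableEq V] (a b : V) :
    edgeSwap s(a, b) = Equiv.swap a b := rfl

theorem blockPerm_bot {n : ℕ} :
    blockPerm (⊥ : Finpartition (Finset.univ : Finset (Fin (n + 1)))) = 1 := by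
  refine Equiv.ext fun v => ?_
  rw [blockPerm_apply, Equiv.Perm.one_apply]
  exact (Finpartition.part_bot_eq_part_bot_iff.1 (part_nextVertex _ v))

theorem blockPerm_eq_finRotate {n : ℕ} (hn : 1 ≤ n)
    {p : Finpartition (Finset.univ : Finset (Fin (n + 1)))} (hp : ∀ a b, p.part a = p.part b) :
    blockPerm p = finRotate (n + 1) := by
  refine Equiv.ext fun v => ?_
  rw [blockPerm_apply]
  refine nextVertex_eq_of_forall_le (hp _ _) fun u _ => ?_
  rw [cyclicDist_finRotate hn]
  exact cyclicDist_pos v u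

/-! ### Covering relations and labels of maximal chains. -/

namespace ConvexPolygon

variable {n : ℕ} {P : ConvexPolygon n}

theorem NC.isNoncrossing (hn : 2 ≤ n) (x : P.NC) : x.1.IsNoncrossing :=
  (P.disjoint_hull_parts_iff_isNoncrossing hn x.1).1 x.2

variable (P) in
/-- The noncrossing partition into single vertices. -/
def discreteNC (hn : 2 ≤ n) : P.NC :=
  ⟨⊥, (P.disjoint_hull_parts_iff_isNoncrossing hn _).2 Finpartition.isNoncrossing_bot⟩

theorem discreteNC_le (hn : 2 ≤ n) (x : P.NC) : P.discreteNC hn ≤ x :=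
  show (⊥ : Finpartition _) ≤ x.1 from bot_le

variable (P) in
/-- The noncrossing partition with a single block. -/
def indiscreteNC : P.NC :=
  ⟨Finpartition.indiscrete (Finset.univ_nonempty (α := Fin (n + 1))).ne_empty, by
    intro s hs t ht hst
    simp only [Finpartition.indiscrete, Finset.mem_singleton] at hs ht
    exact absurd (hs.trans ht.symm) hst⟩

theorem card_parts_indiscreteNC : P.indiscreteNC.1.parts.card = 1 := rfl

theorem le_indiscreteNC (x : P.NC) : x ≤ P.indiscreteNC := by
  intro s _
  exact ⟨Finset.univ, Finset.mem_singleton_self _, Finset.subset_univ s⟩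

theorem part_indiscreteNC (a b : Fin (n + 1)) :
    P.indiscreteNC.1.part a = P.indiscreteNC.1.part b := by
  have h : ∀ c, P.indiscreteNC.1.part c = Finset.univ := fun c =>
    Finpartition.part_eq_of_mem _ (Finset.mem_singleton_self _) (Finset.mem_univ c)
  rw [h, h]

theorem NC.part_eq_of_le {x y : P.NC} (h : x ≤ y) {a b : Fin (n + 1)}
    (hab : x.1.part a = x.1.part b) : y.1.part a = y.1.part b :=
  Finpartition.le_iff_part_eq.1 h a b hab

theorem exists_merge_le_of_lt (hn : 2 ≤ n) {x y : P.NC} (h : x < y) :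
    ∃ (u : Fin (n + 1)) (z : P.NC), x.1.part u ≠ x.1.part (nextVertex y.1 u) ∧
      z.1 = x.1.merge u (nextVertex y.1 u) ∧ x < z ∧ z ≤ y := by
  obtain ⟨u, hu⟩ := Finpartition.exists_part_nextVertex_ne (Subtype.coe_lt_coe.2 h)
  have hle : x.1 ≤ y.1 := h.le
  refine ⟨u, ⟨x.1.merge u (nextVertex y.1 u), (P.disjoint_hull_parts_iff_isNoncrossing hn _).2
    ((x.isNoncrossing hn).merge_nextVertex (y.isNoncrossing hn) hle u)⟩, hu, rfl, ?_,
    Finpartition.merge_le hle (part_nextVertex y.1 u).symm⟩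
  refine lt_of_le_not_ge (Finpartition.le_merge (p := x.1) _ _) fun hge => hu ?_
  exact NC.part_eq_of_le hge (Finpartition.part_merge_eq u _)

/-- This makes the lattice graded by the number of blocks. -/
theorem exists_card_parts_succ_of_lt (hn : 2 ≤ n) {x y : P.NC} (h : x < y) :
    ∃ z : P.NC, x < z ∧ z ≤ y ∧ z.1.parts.card + 1 = x.1.parts.card := by
  obtain ⟨u, z, hu, hz, hxz, hzy⟩ := exists_merge_le_of_lt hn h
  exact ⟨z, hxz, hzy, by rw [hz, Finpartition.card_parts_merge hu]⟩

theorem card_parts_lt_of_lt (hn : 2 ≤ n) {x y : P.NC} (h : x < y) :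
    y.1.parts.card < x.1.parts.card := by
  obtain ⟨z, -, hzy, hz⟩ := exists_card_parts_succ_of_lt hn h
  have := Finpartition.card_mono (show z.1 ≤ y.1 from hzy)
  omega

/-- The edge of a covering relation: it joins two vertices in distinct blocks of the smaller
partition, whose blocks get merged and lie on different sides of the edge. -/
theorem exists_edge_of_covBy (hn : 2 ≤ n) {x y : P.NC} (h : x ⋖ y) : ∃ a b : Fin (n + 1),
    blockPerm y.1 * (blockPerm x.1)⁻¹ = Equiv.swap a b ∧ x.1.part a ≠ x.1.part b ∧
    y.1 = x.1.merge a b ∧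
    (∀ c, x.1.part c = x.1.part a → c ≠ a → cyclicDist a c < cyclicDist a b) ∧
    (∀ c, x.1.part c = x.1.part b → c ≠ b → cyclicDist b c < cyclicDist b a) := by
  obtain ⟨u, z, hu, hz, hxz, hzy⟩ := exists_merge_le_of_lt hn h.lt
  obtain rfl : z = y := by
    by_contra hne
    exact h.2 hxz (lt_of_le_of_ne hzy hne)
  obtain ⟨w, hw⟩ := (nextVertex_bijective x.1).2 (nextVertex z.1 u)
  have hperm := Finpartition.blockPerm_merge (x.isNoncrossing hn) hz hu hw
  have hpa : x.1.part (nextVertex x.1 u) = x.1.part u := part_nextVertex x.1 u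
  have hpw : x.1.part w = x.1.part (nextVertex z.1 u) := by rw [← hw, part_nextVertex]
  have hzw : nextVertex z.1 w = nextVertex x.1 u := by
    have := congrArg (fun σ : Equiv.Perm (Fin (n + 1)) => σ w) hperm
    simpa [blockPerm_apply, hw] using this
  have hne : x.1.part (nextVertex x.1 u) ≠ x.1.part (nextVertex z.1 u) := by rwa [hpa]
  have hne' : nextVertex x.1 u ≠ nextVertex z.1 u := fun h => hne (by rw [h])
  refine ⟨nextVertex x.1 u, nextVertex z.1 u, by rw [hperm, mul_inv_cancel_right], hne, ?_, ?_, ?_⟩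
  · refine le_antisymm ?_ ?_
    · rw [hz]
      refine Finpartition.merge_le (Finpartition.le_merge _ _) ?_
      rw [← hz, Finpartition.part_merge_eq_iff]
      exact Or.inr ⟨Or.inl hpa.symm, Or.inr rfl⟩
    · refine Finpartition.merge_le hxz.le ?_
      rw [part_nextVertex]
      exact NC.part_eq_of_le hxz.le hpa
  · intro c hc hca
    refine cyclicDist_lt_of_consecutive hne' hca ?_ (cyclicDist_nextVertex_le (hc.trans hpa))
    exact cyclicDist_nextVertex_le (NC.part_eq_of_le hxz.le hpa)
  · intro c hc hcb
    refine cyclicDist_lt_of_consecutive hne'.symm hcb (u := w) ?_ ?_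
    · rw [← hzw]
      exact cyclicDist_nextVertex_le (NC.part_eq_of_le hxz.le hpw.symm)
    · rw [← hw]
      exact cyclicDist_nextVertex_le (hc.trans hpw.symm)

theorem hull_sym2 (c d : Fin (n + 1)) : P.hull {v | v ∈ s(c, d)} = P.hull {c, d} := by
  congr 1
  ext v
  simp

theorem WeaklyNoncrossing.symm {e f : Sym2 (Fin (n + 1))} (h : P.WeaklyNoncrossing e f) :
    P.WeaklyNoncrossing f e := by
  rcases h with h | ⟨v, h1, h2, h3⟩
  · exact Or.inl h.symm
  · exact Or.inr ⟨v, h2, h1, by rwa [Set.inter_comm]⟩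

theorem weaklyNoncrossing_of_cyclicDist_lt (hn : 2 ≤ n) {a b c d : Fin (n + 1)} (hcd : c ≠ d)
    (hab : a ≠ b) (hcb : c ≠ b) (hdb : d ≠ b) (hc : c ≠ a → cyclicDist a c < cyclicDist a b)
    (hd : d ≠ a → cyclicDist a d < cyclicDist a b) :
    P.WeaklyNoncrossing s(c, d) s(a, b) := by
  unfold WeaklyNoncrossing
  simp only [hull_sym2]
  by_cases hca : c = a
  · subst hca
    exact Or.inr ⟨c, by simp, by simp, P.hull_pair_inter_hull_pair hcd hab hdb⟩
  by_cases hda : d = a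
  · subst hda
    refine Or.inr ⟨d, by simp, by simp, ?_⟩
    rw [Set.pair_comm c d]
    exact P.hull_pair_inter_hull_pair hcd.symm hab hcb
  specialize hc hca
  specialize hd hda
  have := a.2
  have := b.2
  have := c.2
  have := d.2
  have n1 : (a : ℕ) ≠ b := fun h => hab (Fin.ext h)
  have n2 : (c : ℕ) ≠ a := fun h => hca (Fin.ext h)
  have n3 : (d : ℕ) ≠ a := fun h => hda (Fin.ext h)
  have n4 : (c : ℕ) ≠ b := fun h => hcb (Fin.ext h)
  have n5 : (d : ℕ) ≠ b := fun h => hdb (Fin.ext h)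
  left
  have key := P.disjoint_hull_of_noncrossing hn (s := {c, d}) (t := {a, b}) ?_ ?_ ?_
  · simpa using key
  · simp [Finset.disjoint_left, hca, hda, hcb, hdb]
  all_goals
    intro p hp q hq r hr s hs h1 h2 h3
    simp only [Finset.mem_insert, Finset.mem_singleton] at hp hq hr hs
    simp only [Fin.lt_def] at h1 h2 h3
    unfold cyclicDist at hc hd
    rcases hp with rfl | rfl <;> rcases hr with rfl | rfl <;> try omega
    all_goals
      rcases hq with rfl | rfl <;> rcases hs with rfl | rfl <;> try omega
    all_goals split_ifs at hc hd <;> omega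

/-- The edges of earlier steps lie within blocks of `x`. If the block of `{c, d}` is one of the two
merged, it lies to one side of the new edge, touching it at most in an endpoint; otherwise it
survives in `y` as a block other than the merged one, and hulls of distinct blocks are disjoint. -/
theorem weaklyNoncrossing_of_part_eq (hn : 2 ≤ n) {x y : P.NC} {a b c d : Fin (n + 1)}
    (hab : x.1.part a ≠ x.1.part b) (hy : y.1 = x.1.merge a b)
    (ha : ∀ c, x.1.part c = x.1.part a → c ≠ a → cyclicDist a c < cyclicDist a b)
    (hb : ∀ c, x.1.part c = x.1.part b → c ≠ b → cyclicDist b c < cyclicDist b a)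
    (hcd : c ≠ d) (hx : x.1.part c = x.1.part d) : P.WeaklyNoncrossing s(c, d) s(a, b) := by
  have hab' : a ≠ b := fun h => hab (by rw [h])
  have hne : ∀ {v w}, x.1.part v ≠ x.1.part w → v ≠ w := fun h h' => h (by rw [h'])
  by_cases hca : x.1.part c = x.1.part a
  · exact weaklyNoncrossing_of_cyclicDist_lt hn hcd hab' (hne (by rwa [hca]))
      (hne (by rwa [← hx, hca])) (ha c hca) (ha d (hx ▸ hca))
  by_cases hcb : x.1.part c = x.1.part b
  · rw [Sym2.eq_swap (a := a)]
    exact weaklyNoncrossing_of_cyclicDist_lt hn hcd hab'.symm (hne (by rw [hcb]; exact hab.symm))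
      (hne (by rw [← hx, hcb]; exact hab.symm)) (hb c hcb) (hb d (hx ▸ hcb))
  · left
    simp only [hull_sym2]
    have hyc : y.1.part c ≠ y.1.part a := by
      rw [hy, Ne, Finpartition.part_merge_eq_iff]
      tauto
    have hsub : ∀ {v w}, y.1.part v = y.1.part w → ({v, w} : Set (Fin (n + 1))) ⊆ y.1.part v := by
      intro v w h
      rw [Set.insert_subset_iff, Set.singleton_subset_iff]
      exact ⟨y.1.mem_part (Finset.mem_univ v), Finpartition.mem_part_iff_part_eq.2 h.symm⟩
    refine Disjoint.mono (P.hull_mono (hsub ?_)) (P.hull_mono (hsub ?_)) (y.2 _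
      (y.1.part_mem.2 (Finset.mem_univ c)) _ (y.1.part_mem.2 (Finset.mem_univ a)) hyc)
    · rw [hy, Finpartition.part_merge_eq_iff]
      exact Or.inl hx
    · rw [hy]
      exact Finpartition.part_merge_eq a b

theorem MaximalChain.monotone (C : P.MaximalChain) : Monotone C.elem :=
  Fin.monotone_iff_le_succ.2 fun i => (C.covBy i).le

theorem MaximalChain.elem_zero_eq (hn : 2 ≤ n) (C : P.MaximalChain) : (C.elem 0).1 = ⊥ :=
  le_bot_iff.1 (C.isBot (P.discreteNC hn))

theorem MaximalChain.part_elem_last (C : P.MaximalChain) (a b : Fin (n + 1)) :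
    (C.elem (Fin.last n)).1.part a = (C.elem (Fin.last n)).1.part b :=
  NC.part_eq_of_le (C.isTop P.indiscreteNC) (part_indiscreteNC a b)

theorem MaximalChain.exists_labels (hn : 2 ≤ n) (C : P.MaximalChain) :
    ∃ T : P.ProperlyOrderedTree, T.Labels C := by
  choose a b hperm hne hmerge ha hb using fun k => exists_edge_of_covBy hn (C.covBy k)
  have hab : ∀ k, a k ≠ b k := fun k h => hne k (by rw [h])
  have hlt : ∀ k l, k < l → (C.elem l.castSucc).1.part (a k) = (C.elem l.castSucc).1.part (b k) := by
    intro k l hkl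
    refine NC.part_eq_of_le (C.monotone (Fin.succ_le_castSucc_iff.2 hkl)) ?_
    rw [hmerge]
    exact Finpartition.part_merge_eq _ _
  have hwlt : ∀ k l, k < l → P.WeaklyNoncrossing s(a k, b k) s(a l, b l) := fun k l hkl =>
    weaklyNoncrossing_of_part_eq hn (hne l) (hmerge l) (ha l) (hb l) (hab k) (hlt k l hkl)
  have hinjlt : ∀ k l, k < l → s(a k, b k) ≠ s(a l, b l) := by
    intro k l hkl h
    have := hlt k l hkl
    rcases Sym2.eq_iff.1 h with ⟨h1, h2⟩ | ⟨h1, h2⟩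
    · exact hne l (by rw [← h1, ← h2, this])
    · exact hne l (by rw [← h1, ← h2, this])
  have hinj : Function.Injective fun k => s(a k, b k) := by
    intro k l h
    rcases lt_trichotomy k l with hkl | hkl | hkl
    · exact absurd h (hinjlt k l hkl)
    · exact hkl
    · exact absurd h.symm (hinjlt l k hkl)
  have hdiag : ∀ k, ¬ (s(a k, b k)).IsDiag := fun k => by simpa using hab k
  have hreach : ∀ k, ∀ v w, (C.elem k).1.part v = (C.elem k).1.part w →
      (SimpleGraph.fromEdgeSet (Set.range fun k => s(a k, b k))).Reachable v w := by
    intro k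
    induction k using Fin.induction with
    | zero =>
      intro v w h
      rw [C.elem_zero_eq hn, Finpartition.part_bot_eq_part_bot_iff] at h
      rw [h]
    | succ k ih =>
      intro v w h
      have hadj : (SimpleGraph.fromEdgeSet (Set.range fun k => s(a k, b k))).Reachable
          (a k) (b k) :=
        SimpleGraph.Adj.reachable ((SimpleGraph.fromEdgeSet_adj _).2 ⟨⟨k, rfl⟩, hab k⟩)
      rw [hmerge, Finpartition.part_merge_eq_iff] at h
      rcases h with h | ⟨hv, hw⟩
      · exact ih v w h
      · have key : ∀ v, (C.elem k.castSucc).1.part v = (C.elem k.castSucc).1.part (a k) ∨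
            (C.elem k.castSucc).1.part v = (C.elem k.castSucc).1.part (b k) →
            (SimpleGraph.fromEdgeSet (Set.range fun k => s(a k, b k))).Reachable v (a k) := by
          rintro v (h | h)
          · exact ih v _ h
          · exact (ih v _ h).trans hadj.symm
        exact (key v hv).trans (key w hw).symm
  refine ⟨⟨fun k => s(a k, b k), hinj, hdiag, ?_, ?_, ?_⟩, hperm⟩
  · rw [SimpleGraph.isTree_iff_connected_and_card]
    -- Connectedness together with the count of `n` edges on `n + 1` vertices gives a tree.
    refine ⟨⟨fun v w => hreach (Fin.last n) v w (C.part_elem_last v w)⟩, ?_⟩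
    have : (SimpleGraph.fromEdgeSet (Set.range fun k => s(a k, b k))).edgeSet =
        Set.range fun k => s(a k, b k) := by
      rw [SimpleGraph.edgeSet_fromEdgeSet, sdiff_eq_left]
      refine Set.disjoint_left.2 ?_
      rintro _ ⟨k, rfl⟩ h
      exact hdiag k h
    rw [this, Nat.card_range_of_injective hinj]
    simp
  · intro k l hkl
    rcases lt_or_gt_of_ne hkl with h | h
    · exact hwlt k l h
    · exact (hwlt l k h).symm
  · have hswap : (fun k => edgeSwap s(a k, b k)) = fun k =>
        blockPerm (C.elem k.succ).1 * (blockPerm (C.elem k.castSucc).1)⁻¹ := by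
      funext k
      rw [hperm, edgeSwap_mk]
    -- The product telescopes to the quotient of the block permutations of top and bottom.
    rw [hswap, prod_reverse_ofFn_div fun k => blockPerm (C.elem k).1]
    rw [C.elem_zero_eq hn, blockPerm_bot, blockPerm_eq_finRotate (by omega) C.part_elem_last,
      inv_one, mul_one]

/-- By gradedness, a chain that is maximal under inclusion has exactly one member for each number of
blocks from `n + 1` down to `1`; listing them by that number gives the covering relations. -/
theorem exists_maximalChain_of_isChain (hn : 2 ≤ n) {s : Set P.NC} (hs : IsChain (· ≤ ·) s) :
    ∃ C : P.MaximalChain, s ⊆ Set.range C.elem := by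
  obtain ⟨F, hF, hsF⟩ := hs.exists_maxChain
  have hmem : ∀ x, (∀ y ∈ F, x ≤ y ∨ y ≤ x) → x ∈ F := by
    intro x hx
    rw [hF.2 (hF.1.insert fun y hy _ => hx y hy) (Set.subset_insert x F)]
    exact Set.mem_insert x F
  have hbot : P.discreteNC hn ∈ F := hmem _ fun y _ => Or.inl (discreteNC_le hn y)
  have htop : P.indiscreteNC ∈ F := hmem _ fun y _ => Or.inr (le_indiscreteNC y)
  have hcbot : (P.discreteNC hn).1.parts.card = n + 1 := by
    rw [discreteNC, Finpartition.card_bot, Finset.card_univ, Fintype.card_fin]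
  have hcard : ∀ x : P.NC, 1 ≤ x.1.parts.card ∧ x.1.parts.card ≤ n + 1 := by
    intro x
    have h1 := Finpartition.card_mono (show x.1 ≤ P.indiscreteNC.1 from le_indiscreteNC x)
    have h2 := Finpartition.card_mono (show (P.discreteNC hn).1 ≤ x.1 from discreteNC_le hn x)
    rw [card_parts_indiscreteNC] at h1
    rw [hcbot] at h2
    exact ⟨h1, h2⟩
  have hex : ∀ k : Fin (n + 1), ∃ x ∈ F, x.1.parts.card + k = n + 1 := by
    intro k
    have hk := k.2
    obtain ⟨x, ⟨hxF, hx⟩, hmin⟩ := (Set.toFinite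
      {x | x ∈ F ∧ n + 1 ≤ x.1.parts.card + k}).exists_minimalFor
        (fun x : P.NC => x.1.parts.card) _ ⟨P.discreteNC hn, hbot, by rw [hcbot]; omega⟩
    refine ⟨x, hxF, le_antisymm ?_ hx⟩
    by_contra! hlt
    have hxtop : x < P.indiscreteNC := by
      refine lt_of_le_of_ne (le_indiscreteNC x) ?_
      rintro rfl
      rw [card_parts_indiscreteNC] at hlt
      omega
    obtain ⟨y, hy⟩ := (Set.toFinite {y | y ∈ F ∧ x < y}).exists_minimal ⟨_, htop, hxtop⟩
    obtain ⟨z, hxz, hzy, hz⟩ := exists_card_parts_succ_of_lt hn hy.prop.2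
    -- Here `y` is the next member of `F` above `x`, so an element between them is comparable with
    -- all of `F`.
    have hzF : z ∈ F := by
      refine hmem z fun t ht => ?_
      rcases hF.1.total hxF ht with hxt | htx
      · rcases hxt.eq_or_lt with rfl | hxt
        · exact Or.inr hxz.le
        · left
          rcases hF.1.total ht hy.prop.1 with h | h
          · exact hzy.trans (hy.le_of_le ⟨ht, hxt⟩ h)
          · exact hzy.trans h
      · exact Or.inr (htx.trans hxz.le)
    have := hmin (j := z) ⟨hzF, by omega⟩ (show z.1.parts.card ≤ x.1.parts.card by omega)
    change x.1.parts.card ≤ z.1.parts.card at this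
    omega
  choose f hfF hf using hex
  have hcardlt : ∀ {x y}, x ∈ F → y ∈ F → y.1.parts.card < x.1.parts.card → x < y := by
    intro x y hx hy h
    rcases hF.1.total hx hy with h' | h'
    · exact lt_of_le_of_ne h' (by rintro rfl; exact lt_irrefl _ h)
    · exact absurd (Finpartition.card_mono (show y.1 ≤ x.1 from h')) (not_le.2 h)
  have hcardeq : ∀ {x y}, x ∈ F → y ∈ F → y.1.parts.card = x.1.parts.card → x = y := by
    intro x y hx hy h
    by_contra hne
    rcases hF.1.total hx hy with h' | h'
    · have := card_parts_lt_of_lt hn (lt_of_le_of_ne h' hne)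
      omega
    · have := card_parts_lt_of_lt hn (lt_of_le_of_ne h' (Ne.symm hne))
      omega
  refine ⟨⟨f, ?_, ?_, fun k => ⟨?_, ?_⟩⟩, fun x hx => ?_⟩
  · have := hf 0
    rw [← hcardeq hbot (hfF 0) (by rw [hcbot]; simpa using this)]
    exact discreteNC_le hn
  · have := hf (Fin.last n)
    rw [Fin.val_last] at this
    rw [← hcardeq htop (hfF (Fin.last n)) (by rw [card_parts_indiscreteNC]; omega)]
    exact le_indiscreteNC
  · have h1 := hf k.castSucc
    have h2 := hf k.succ
    rw [Fin.val_castSucc] at h1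
    rw [Fin.val_succ] at h2
    exact hcardlt (hfF _) (hfF _) (by omega)
  · intro y h1 h2
    have h3 := hf k.castSucc
    have h4 := hf k.succ
    rw [Fin.val_castSucc] at h3
    rw [Fin.val_succ] at h4
    have := card_parts_lt_of_lt hn h1
    have := card_parts_lt_of_lt hn h2
    omega
  · have hc := hcard x
    refine ⟨⟨n + 1 - x.1.parts.card, by omega⟩, hcardeq (hfF _) (hsF hx) ?_⟩
    have := hf ⟨n + 1 - x.1.parts.card, by omega⟩
    change x.1.parts.card = (f _).1.parts.card
    dsimp only at this
    omega

end ConvexPolygon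

/-! ### The omitting complex as a union of stars, and joins with a fixed element. -/

namespace ConvexPolygon

variable {n : ℕ} {P : ConvexPolygon n}

/-- The vertex `i` shares its block with some other vertex but not with the clockwise next one. -/
def JoinedAvoidingNext (i : Fin (n + 1)) (x : P.NC) : Prop :=
  (∃ k, k ≠ i ∧ x.1.part i = x.1.part k) ∧ x.1.part i ≠ x.1.part (finRotate (n + 1) i)

theorem finRotate_ne_self (hn : 2 ≤ n) (i : Fin (n + 1)) : finRotate (n + 1) i ≠ i := by
  intro h
  have h1 := cyclicDist_finRotate (show 1 ≤ n by omega) i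
  rw [h, cyclicDist_self] at h1
  omega

theorem JoinedAvoidingNext.of_le {i : Fin (n + 1)} {x y : P.NC} (hx : JoinedAvoidingNext i x)
    (hxy : x ≤ y) (hy : y.1.part i ≠ y.1.part (finRotate (n + 1) i)) : JoinedAvoidingNext i y := by
  obtain ⟨⟨k, hk, h⟩, -⟩ := hx
  exact ⟨⟨k, hk, NC.part_eq_of_le hxy h⟩, hy⟩

/-- Merging the block of `i` with that of the preceding vertex of the block of `i` in a coarser
partition. -/
theorem JoinedAvoidingNext.exists_merge (hn : 2 ≤ n) {i v : Fin (n + 1)} {x m z : P.NC}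
    (hm : JoinedAvoidingNext i m) (hxm : x ≤ m) (hmz : m ≤ z) (hv : nextVertex z.1 v = i) :
    ∃ j : P.NC, j.1 = x.1.merge v i ∧ JoinedAvoidingNext i j ∧ j ≤ z := by
  obtain ⟨⟨k, hki, hk⟩, hmi⟩ := hm
  have hzv : z.1.part v = z.1.part i := by rw [← hv, part_nextVertex]
  have hzk : z.1.part k = z.1.part i := (NC.part_eq_of_le hmz hk).symm
  have hik := cyclicDist_nextVertex_le (p := z.1) (hzk.trans hzv.symm)
  rw [hv] at hik
  have hi1 := cyclicDist_finRotate (show 1 ≤ n by omega) i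
  have hk1 : finRotate (n + 1) i ≠ k := by
    rintro rfl
    exact hmi hk
  set i' := finRotate (n + 1) i with hi'
  have b1 := i.2
  have b2 := i'.2
  have b3 := k.2
  have b4 := v.2
  have n1 : (k : ℕ) ≠ i := fun h => hki (Fin.ext h)
  have n2 : (i' : ℕ) ≠ k := fun h => hk1 (Fin.ext h)
  have hvi : v ≠ i := by
    rintro rfl
    unfold cyclicDist at hik
    split_ifs at hik <;> omega
  have n3 : (v : ℕ) ≠ i := fun h => hvi (Fin.ext h)
  have hbc : cyclicDist i i' < cyclicDist i k := by
    unfold cyclicDist at *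
    split_ifs at * <;> omega
  -- Clockwise from `i` come `i'`, then `k`, then `v` (possibly equal to `k`). If `m` joined `i'` to
  -- `v`, that chord would cross the one from `i` to `k`, forcing `i` and `i'` into one block.
  have hmv : m.1.part i' ≠ m.1.part v := by
    intro h
    rcases eq_or_ne k v with rfl | hkv
    · exact hmi (hk.trans h.symm)
    · have n4 : (k : ℕ) ≠ v := fun h => hkv (Fin.ext h)
      have hcd : cyclicDist i k < cyclicDist i v := by
        unfold cyclicDist at *
        split_ifs at * <;> omega
      exact hmi ((m.isNoncrossing hn).part_eq_of_cyclicDist_lt hbc hcd hk h)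
  have hnc := (x.isNoncrossing hn).merge_nextVertex (z.isNoncrossing hn) (hxm.trans hmz) v
  rw [hv] at hnc
  refine ⟨⟨x.1.merge v i, (P.disjoint_hull_parts_iff_isNoncrossing hn _).2 hnc⟩, rfl,
    ⟨⟨v, hvi, (Finpartition.part_merge_eq v i).symm⟩, ?_⟩,
    Finpartition.merge_le (hxm.trans hmz) hzv⟩
  rw [Ne, Finpartition.part_merge_eq_iff]
  rintro (h | ⟨-, h | h⟩)
  · exact hmi (NC.part_eq_of_le hxm h)
  · exact hmv (NC.part_eq_of_le hxm h)
  · exact hmi (NC.part_eq_of_le hxm h).symm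

theorem JoinedAvoidingNext.not_isBot (hn : 2 ≤ n) {i : Fin (n + 1)} {x : P.NC}
    (hx : JoinedAvoidingNext i x) : ¬ IsBot x := by
  intro h
  obtain ⟨⟨k, hk, hik⟩, -⟩ := hx
  have := NC.part_eq_of_le (h (P.discreteNC hn)) hik
  exact hk (Finpartition.part_bot_eq_part_bot_iff.1 this).symm

theorem JoinedAvoidingNext.not_isTop {i : Fin (n + 1)} {x : P.NC}
    (hx : JoinedAvoidingNext i x) : ¬ IsTop x :=
  fun h => hx.2 (NC.part_eq_of_le (h P.indiscreteNC) (part_indiscreteNC _ _))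

/-- A maximal chain labeled by a tree omits a boundary edge if and only if some element of the chain
joins the first endpoint of the edge to another vertex before it gets joined to the second. -/
theorem ProperlyOrderedTree.Labels.notMem_range_edge_iff (hn : 2 ≤ n) {T : P.ProperlyOrderedTree}
    {C : P.MaximalChain} (h : T.Labels C) (i : Fin (n + 1)) :
    s(i, finRotate (n + 1) i) ∉ Set.range T.edge ↔ ∃ k, JoinedAvoidingNext i (C.elem k) := by
  have hne := finRotate_ne_self hn i
  have hi1 := cyclicDist_finRotate (show 1 ≤ n by omega) i
  set i' := finRotate (n + 1) i with hi'
  constructor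
  · intro he
    by_contra! hC
    -- As long as `M` is avoided and the edge is not used, `i` stays a singleton: a step leaving
    -- this state would join `i` to `i'` at once, and its transposition would send `i` to `i'`. The
    -- top of the chain contradicts this.
    have key : ∀ k, ∀ l, (C.elem k).1.part i = (C.elem k).1.part l → l = i := by
      intro k
      induction k using Fin.induction with
      | zero =>
        intro l hl
        rw [C.elem_zero_eq hn, Finpartition.part_bot_eq_part_bot_iff] at hl
        exact hl.symm
      | succ k ih =>
        intro l hl
        by_contra hli
        have hpart : (C.elem k.succ).1.part i = (C.elem k.succ).1.part i' := by
          by_contra hp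
          exact hC _ ⟨⟨l, hli, hl⟩, hp⟩
        have h1 : nextVertex (C.elem k.castSucc).1 i = i :=
          ih _ (part_nextVertex _ i).symm
        have h2 : nextVertex (C.elem k.succ).1 i = i' := by
          refine nextVertex_eq_of_forall_le hpart.symm fun u _ => ?_
          rw [hi1]
          exact cyclicDist_pos i u
        have h3 : (blockPerm (C.elem k.castSucc).1)⁻¹ i = i := by
          rw [Equiv.Perm.inv_eq_iff_eq]
          exact h1.symm
        have h4 := congrArg (fun σ : Equiv.Perm (Fin (n + 1)) => σ i) (h k)
        simp only [Equiv.Perm.mul_apply, h3, blockPerm_apply, h2] at h4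
        refine he ⟨k, ?_⟩
        revert h4
        induction T.edge k with
        | _ a b =>
        rw [edgeSwap_mk, Equiv.swap_apply_def]
        split_ifs with ha hb
        · rintro rfl
          rw [ha]
        · rintro rfl
          rw [hb, Sym2.eq_swap]
        · exact fun h => absurd h hne
    exact hne (key (Fin.last n) i' (C.part_elem_last _ _))
  · rintro ⟨j, hj⟩ ⟨k, hk⟩
    obtain ⟨a, b, hab, hneab, hmerge, ha, hb⟩ := exists_edge_of_covBy hn (C.covBy k)
    have hswap := h k
    rw [hab, hk, edgeSwap_mk] at hswap
    have hab' : a ≠ b := fun h => hneab (by rw [h])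
    -- The other vertices of the block of `i` would be clockwise strictly closer to `i` than `i'`,
    -- which is at distance `1`.
    have hsing : ∀ c, (C.elem k.castSucc).1.part c = (C.elem k.castSucc).1.part i → c = i := by
      intro c hc
      by_contra hci
      have hpos := cyclicDist_pos i c
      rcases Equiv.swap_eq_swap_cases hab' hswap with ⟨rfl, rfl⟩ | ⟨rfl, rfl⟩
      · have := ha c hc hci
        omega
      · have := hb c hc hci
        omega
    have htop : (C.elem k.succ).1.part i = (C.elem k.succ).1.part i' := by
      have := Finpartition.part_merge_eq (p := (C.elem k.castSucc).1) a b
      rw [← hmerge] at this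
      rcases Equiv.swap_eq_swap_cases hab' hswap with ⟨rfl, rfl⟩ | ⟨rfl, rfl⟩
      · exact this
      · exact this.symm
    rcases le_or_gt j k.castSucc with hjk | hjk
    · obtain ⟨⟨c, hci, hc⟩, -⟩ := hj
      exact hci (hsing c (NC.part_eq_of_le (C.monotone hjk) hc).symm)
    · exact hj.2 (NC.part_eq_of_le (C.monotone (Fin.castSucc_lt_iff_succ_le.1 hjk)) htop)

theorem omittingComplex_eq_starComplex (hn : 2 ≤ n) (P : ConvexPolygon n) (i : Fin (n + 1)) :
    P.omittingComplex s(i, finRotate (n + 1) i) =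
      starComplex {x : P.ProperNC | JoinedAvoidingNext i x.1} Set.univ := by
  ext s
  constructor
  · rintro ⟨hs, T, C, hTC, he, hsC⟩
    obtain ⟨k, hk⟩ := (hTC.notMem_range_edge_iff hn i).1 he
    refine ⟨hs, Set.subset_univ _, ⟨C.elem k, hk.not_isBot hn, hk.not_isTop⟩, ⟨hk, trivial⟩, ?_⟩
    have hC : ∀ x ∈ insert (⟨C.elem k, hk.not_isBot hn, hk.not_isTop⟩ : P.ProperNC)
        (s : Set P.ProperNC), (x : P.NC) ∈ Set.range C.elem := by
      rintro x (rfl | hx)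
      · exact ⟨k, rfl⟩
      · exact hsC x hx
    intro x hx y hy _
    obtain ⟨a, ha⟩ := hC x hx
    obtain ⟨b, hb⟩ := hC y hy
    change (x : P.NC) ≤ y ∨ (y : P.NC) ≤ x
    rw [← ha, ← hb]
    exact (le_total a b).imp (fun h => C.monotone h) fun h => C.monotone h
  · rintro ⟨hs, -, m, ⟨hm, -⟩, hc⟩
    obtain ⟨C, hC⟩ := exists_maximalChain_of_isChain hn
      (s := Subtype.val '' (insert m (s : Set P.ProperNC))) (by
        rintro _ ⟨x, hx, rfl⟩ _ ⟨y, hy, rfl⟩ _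
        exact hc.total hx hy)
    obtain ⟨T, hT⟩ := C.exists_labels hn
    obtain ⟨k, hk⟩ := hC ⟨m, Set.mem_insert m _, rfl⟩
    exact ⟨hs, T, C, hT, (hT.notMem_range_edge_iff hn i).2 ⟨k, by rw [hk]; exact hm⟩,
      fun x hx => hC ⟨x, Set.mem_insert_of_mem m hx, rfl⟩⟩

theorem omittingComplex_le_link (e : Sym2 (Fin (n + 1))) : P.omittingComplex e ≤ P.link := by
  rintro s ⟨hs, T, C, -, -, hsC⟩
  refine ⟨hs, fun x hx y hy _ => ?_⟩
  obtain ⟨a, ha⟩ := hsC x hx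
  obtain ⟨b, hb⟩ := hsC y hy
  change (x : P.NC) ≤ y ∨ (y : P.NC) ≤ x
  rw [← ha, ← hb]
  exact (le_total a b).imp (fun h => C.monotone h) fun h => C.monotone h

/-- Below a noncrossing partition that joins `i` to the next vertex, the partitions that join `i` to
some vertex but not to the next one have joins with a fixed one of them. -/
theorem JoinedAvoidingNext.exists_isLUB (hn : 2 ≤ n) {i : Fin (n + 1)} {z : P.NC}
    (hz : z.1.part i = z.1.part (finRotate (n + 1) i))
    (hne : ∃ m : P.ProperNC, JoinedAvoidingNext i m.1 ∧ m.1 < z) :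
    ∃ p : P.ProperNC, (JoinedAvoidingNext i p.1 ∧ p.1 < z) ∧
      ∀ m : P.ProperNC, JoinedAvoidingNext i m.1 ∧ m.1 < z → ∀ x ≤ m,
        ∃ j : P.ProperNC, (JoinedAvoidingNext i j.1 ∧ j.1 < z) ∧ IsLUB {x, p} j := by
  obtain ⟨v, hv⟩ := (nextVertex_bijective z.1).2 i
  have key : ∀ m : P.NC, JoinedAvoidingNext i m → m < z → ∀ x ≤ m,
      ∃ j : P.ProperNC, (JoinedAvoidingNext i j.1 ∧ j.1 < z) ∧ j.1.1 = x.1.merge v i := by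
    intro m hm hmz x hxm
    obtain ⟨j, hj, hji, hjz⟩ := hm.exists_merge hn hxm hmz.le hv
    refine ⟨⟨j, hji.not_isBot hn, hji.not_isTop⟩, ⟨hji, lt_of_le_of_ne hjz ?_⟩, hj⟩
    rintro rfl
    exact hji.2 hz
  obtain ⟨m₀, hm₀, hm₀z⟩ := hne
  -- The merge applied to the discrete partition gives the fixed element, whose only nontrivial
  -- block is `{v, i}`.
  obtain ⟨p, hp, hpm⟩ := key m₀.1 hm₀ hm₀z _ (discreteNC_le hn m₀.1)
  refine ⟨p, hp, fun m hm x hxm => ?_⟩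
  obtain ⟨j, hj, hjx⟩ := key m.1 hm.1 hm.2 x.1 hxm
  refine ⟨j, hj, ?_, ?_⟩
  · rintro y (rfl | rfl)
    · change y.1.1 ≤ j.1.1
      rw [hjx]
      exact Finpartition.le_merge v i
    · change y.1.1 ≤ j.1.1
      rw [hpm, hjx]
      exact Finpartition.merge_le bot_le (Finpartition.part_merge_eq v i)
  · intro y hy
    change j.1.1 ≤ y.1.1
    rw [hjx]
    refine Finpartition.merge_le (hy (Set.mem_insert x _)) ?_
    refine NC.part_eq_of_le (hy (Set.mem_insert_of_mem x rfl)) ?_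
    rw [hpm]
    exact Finpartition.part_merge_eq v i

/-- The partition joining only `i` and its counterclockwise neighbor `v` works, because `v` differs
from the clockwise neighbor when there are at least three vertices. -/
theorem exists_joinedAvoidingNext (hn : 2 ≤ n) (P : ConvexPolygon n) (i : Fin (n + 1)) :
    ∃ x : P.ProperNC, JoinedAvoidingNext i x.1 := by
  obtain ⟨v, hv⟩ := (finRotate (n + 1)).surjective i
  have hvi : v ≠ i := fun h => finRotate_ne_self hn i (by rw [← h, hv, h])
  have hnext : nextVertex P.indiscreteNC.1 v = i := by
    rw [← blockPerm_apply, blockPerm_eq_finRotate (by omega) part_indiscreteNC, hv]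
  have hnc := ((P.discreteNC hn).isNoncrossing hn).merge_nextVertex
    (P.indiscreteNC.isNoncrossing hn) (discreteNC_le hn _) v
  rw [hnext] at hnc
  have h : JoinedAvoidingNext i
      (⟨_, (P.disjoint_hull_parts_iff_isNoncrossing hn _).2 hnc⟩ : P.NC) := by
    refine ⟨⟨v, hvi, (Finpartition.part_merge_eq v i).symm⟩, ?_⟩
    have h1 := cyclicDist_finRotate (show 1 ≤ n by omega) i
    have h2 := cyclicDist_finRotate (show 1 ≤ n by omega) v
    have h3 := finRotate_ne_self hn i
    rw [hv] at h2
    rw [Ne, Finpartition.part_merge_eq_iff]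
    simp only [discreteNC, Finpartition.part_bot_eq_part_bot_iff]
    rintro (h | ⟨-, h | h⟩)
    · exact h3 h.symm
    · rw [h] at h1
      have := i.2
      have := v.2
      unfold cyclicDist at h1 h2
      split_ifs at h1 h2 <;> omega
    · exact h3 h
  exact ⟨⟨_, h.not_isBot hn, h.not_isTop⟩, h⟩

end ConvexPolygon

/-! ### Contractibility of the omitting complex. -/

open ConvexPolygon in
theorem contractibleSpace_realization_omittingComplex {n : ℕ} (hn : 2 ≤ n) (P : ConvexPolygon n)
    (i : Fin (n + 1)) :
    ContractibleSpace (realization (P.omittingComplex s(i, finRotate (n + 1) i))) := by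
  rw [omittingComplex_eq_starComplex hn P i]
  refine contractibleSpace_realization_starComplex
    (T := {x : P.ProperNC | x.1.1.part i = x.1.1.part (finRotate (n + 1) i)}) ?_ ?_ ?_ ?_
    (exists_joinedAvoidingNext hn P i)
  · exact fun x y hxy hx => NC.part_eq_of_le hxy hx
  · exact Set.disjoint_left.2 fun x hx hxT => hx.2 hxT
  · rintro x y hxy hx
    by_cases hy : y.1.1.part i = y.1.1.part (finRotate (n + 1) i)
    · exact Or.inr hy
    · rcases hx with hx | hx
      · exact Or.inl (JoinedAvoidingNext.of_le hx hxy hy)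
      · exact absurd (NC.part_eq_of_le hxy hx) hy
  · have key : ∀ (E : Set P.ProperNC) (z : P.NC),
        z.1.part i = z.1.part (finRotate (n + 1) i) → (∀ x, x ∈ E ↔ x.1 < z) →
        ({x : P.ProperNC | JoinedAvoidingNext i x.1} ∩ E).Nonempty →
        ∃ p ∈ {x : P.ProperNC | JoinedAvoidingNext i x.1} ∩ E,
          ∀ m ∈ {x : P.ProperNC | JoinedAvoidingNext i x.1} ∩ E, ∀ x ≤ m,
            ∃ j ∈ {x : P.ProperNC | JoinedAvoidingNext i x.1} ∩ E, IsLUB {x, p} j := by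
      intro E z hz hE hne
      have hmem : ∀ x, x ∈ {x : P.ProperNC | JoinedAvoidingNext i x.1} ∩ E ↔
          JoinedAvoidingNext i x.1 ∧ x.1 < z := fun x => and_congr Iff.rfl (hE x)
      simp only [Set.Nonempty, hmem] at hne ⊢
      exact JoinedAvoidingNext.exists_isLUB hn hz hne
    rintro E (rfl | ⟨z, hz, rfl⟩) hne
    · refine key _ P.indiscreteNC (part_indiscreteNC _ _) (fun x => ?_) hne
      refine ⟨fun _ => lt_of_le_of_ne (le_indiscreteNC _) fun h => x.2.2 ?_, fun _ => trivial⟩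
      rw [h]
      exact le_indiscreteNC
    · exact key _ z.1 hz (fun x => Iff.rfl) hne

theorem theoremA {n : ℕ} (hn : 2 ≤ n) (P : ConvexPolygon n) (i : Fin (n + 1)) :
    P.omittingComplex s(i, finRotate (n + 1) i) ≤ P.link ∧
      ContractibleSpace (realization (P.omittingComplex s(i, finRotate (n + 1) i))) :=
  ⟨ConvexPolygon.omittingComplex_le_link _, contractibleSpace_realization_omittingComplex hn P i⟩
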